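/- For an oriented graph \(G\) (no loops, no multiple arcs, no 2-cycles) and an oriented graph \(H\) on \(k\) vertices, let \(N(H,G)\) be the number of \(k\)-element sets of vertices of \(G\) that induce a graph isomorphic to \(H\). The inducibility of \(H\) is \[ I(H)=\lim_{n\to\infty}\frac{\max\{N(H,G): |V(G)|=n\}}{\binom nk}, \] the maximum being over oriented graphs \(G\) on \(n\) vertices. For \(\alpha\in[0,\frac12]\), the circular graph \(S^1(\alpha)\) has vertex set \([0,1)\) and an arc from \(x\) to \(y\) whenever \(x\neq y\) and \(y=(x+a) \bmod 1\) for some \(a\in[0,\alpha)\). The density of \(H\) in \(S^1(\alpha)\) is the probability that \(k\) independent uniformly random points of \([0,1)\) induce a graph isomorphic to \(H\). Let \(H\) be the oriented graph with vertices \(v,x,y,z\) and exactly the five arcs \(v\to x\), \(v\to y\), \(x\to y\), \(x\to z\), \(y\to z\) (so that \(v\) and \(z\) are the only non-adjacent pair); that is, the transitive tournament on four vertices without the arc from its source to its sink. Then the limit defining \(I(H)\) exists and \[ I(H)=\frac{28+6\sqrt3}{169}. \] Moreover, this value is attained by the circular graph \(S^1(\alpha)\) with \(\alpha=\frac{9+\sqrt3}{26}\):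 the density of \(H\) in \(S^1(\alpha)\) is equal to \[ 4!\int_{\alpha}^{1-\alpha}\tfrac12\bigl(\alpha-(z-\alpha)\bigr)^2\,dz=\frac{28+6\sqrt3}{169}. \] -/

import Mathlib

open Filter Topology MeasureTheory

/-- An oriented graph: a directed graph with no loops, no multiple arcs and no 2-cycles.
(Asymmetry of the arc relation excludes loops as well.) -/
structure OrientedGraph (V : Type*) extends Digraph V where
  asymm : ∀ x y : V, Adj x y → ¬ Adj y x

namespace OrientedGraph

/-- The subgraph of `G` induced on the vertex set `S`. -/
def induce {V : Type*} (G : OrientedGraph V) (S : Set V) : OrientedGraph S where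
  Adj x y := G.Adj x y
  asymm x y h := G.asymm x y h

/-- `S` induces in `G` a graph isomorphic to `H`. -/
def InducesCopy {V W : Type*} (H : OrientedGraph W) (G : OrientedGraph V) (S : Set V) : Prop :=
  Nonempty ((G.induce S).Adj ≃r H.Adj)

/-- `N(H, G)`: the number of `k`-sets of vertices of `G` that induce a graph isomorphic to `H`,
where `k = |V(H)|`. -/
noncomputable def numCopies {V W : Type*} [Fintype V] [Fintype W]
    (H : OrientedGraph W) (G : OrientedGraph V) : ℕ :=
  {S : Finset V | S.card = Fintype.card W ∧ InducesCopy H G (S : Set V)}.ncard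

/-- The maximum of `N(H, G)` over all oriented graphs `G` on `n` vertices. -/
noncomputable def maxCopies {W : Type*} [Fintype W] (H : OrientedGraph W) (n : ℕ) : ℕ :=
  sSup (Set.range fun G : OrientedGraph (Fin n) => numCopies H G)

theorem finite_range_numCopies {W : Type*} [Fintype W] (H : OrientedGraph W) (n : ℕ) :
    (Set.range fun G : OrientedGraph (Fin n) => numCopies H G).Finite := by
  refine (Set.finite_Iic (Fintype.card (Finset (Fin n)))).subset ?_
  rintro _ ⟨G, rfl⟩
  have h := Set.ncard_le_ncard (Set.subset_univ
    {S : Finset (Fin n) | S.card = Fintype.card W ∧ InducesCopy H G (S : Set (Fin n))})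
  rw [Set.ncard_univ, Nat.card_eq_fintype_card] at h
  exact h

/-- The supremum in `maxCopies` is a genuine maximum. -/
theorem isGreatest_maxCopies {W : Type*} [Fintype W] (H : OrientedGraph W) (n : ℕ) :
    IsGreatest (Set.range fun G : OrientedGraph (Fin n) => numCopies H G) (maxCopies H n) := by
  have hne : (Set.range fun G : OrientedGraph (Fin n) => numCopies H G).Nonempty :=
    ⟨_, { Adj := fun _ _ => False, asymm := fun _ _ h => h.elim }, rfl⟩
  exact ⟨Nat.sSup_mem hne (finite_range_numCopies H n).bddAbove,
    fun a ha => le_csSup (finite_range_numCopies H n).bddAbove ha⟩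

/-- The inducibility of `H` exists and equals `c`:
`max {N(H, G) : |V(G)| = n} / (n choose k)` converges to `c` as `n → ∞`. -/
def HasInducibility {W : Type*} [Fintype W] (H : OrientedGraph W) (c : ℝ) : Prop :=
  Tendsto (fun n : ℕ => (maxCopies H n : ℝ) / (n.choose (Fintype.card W) : ℝ)) atTop (𝓝 c)

/-- The density of `H` in a graph `G` whose vertex set carries a probability measure `μ`: the
probability that `k = |V(H)|` independent `μ`-random vertices of `G` induce a graph isomorphic
to `H`.
(If two of the chosen vertices coincide, there is no isomorphism.) -/
noncomputable def density {V W : Type*} [Fintype W] [MeasurableSpace V]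
    (H : OrientedGraph W) (G : OrientedGraph V) (μ : Measure V) : ℝ :=
  (Measure.pi fun _ : W => μ).real
    {p : W → V | InducesCopy H G (Set.range p)}

end OrientedGraph

/-- The circular graph `S¹(α)`, `α ≤ 1/2`, with vertex set `[0, 1)` and an arc from `x` to
`x + a mod 1` for each `x` and each `a ∈ [0, α)` (no loops, as oriented graphs have none). -/
def circularGraph (α : ℝ) (hα : α ≤ 1 / 2) : OrientedGraph (Set.Ico (0 : ℝ) 1) where
  Adj x y := x ≠ y ∧ ∃ a ∈ Set.Ico (0 : ℝ) α, (y : ℝ) = Int.fract ((x : ℝ) + a)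
  asymm := by
    rintro x y ⟨hne, a, ⟨ha0, ha⟩, hy⟩ ⟨-, b, ⟨hb0, hb⟩, hx⟩
    have h1 := Int.self_sub_fract ((x : ℝ) + a)
    have h2 := Int.self_sub_fract ((y : ℝ) + b)
    rw [← hy] at h1
    rw [← hx] at h2
    have hsum : a + b = ((⌊(x : ℝ) + a⌋ + ⌊(y : ℝ) + b⌋ : ℤ) : ℝ) := by
      push_cast; linarith
    have hz : ⌊(x : ℝ) + a⌋ + ⌊(y : ℝ) + b⌋ < 1 := by
      have : a + b < 1 := by linarith
      rw [hsum] at this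
      exact_mod_cast this
    have hz' : ((⌊(x : ℝ) + a⌋ + ⌊(y : ℝ) + b⌋ : ℤ) : ℝ) ≤ 0 := by
      exact_mod_cast Int.lt_add_one_iff.mp hz
    have ha' : a = 0 := by linarith
    refine hne (Subtype.ext ?_)
    rw [hy, ha', add_zero, Int.fract_eq_self.mpr x.2]

/-- The uniform (Lebesgue) probability measure on the vertex set `[0, 1)`. -/
noncomputable def uniformIco : Measure (Set.Ico (0 : ℝ) 1) :=
  Measure.comap Subtype.val volume

theorem isProbabilityMeasure_uniformIco : IsProbabilityMeasure uniformIco :=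
  ⟨by rw [uniformIco, comap_subtype_coe_apply measurableSet_Ico, Set.image_univ,
    Subtype.range_coe, Real.volume_Ico]; simp⟩

/-- The transitive tournament on four vertices `v, x, y, z` (numbered `0, 1, 2, 3`) without the
arc from its source `v` to its sink `z`: the arcs are
`v → x`, `v → y`, `x → y`, `x → z`, `y → z`. -/
def transitiveMinusArc : OrientedGraph (Fin 4) where
  Adj i j := (i, j) ∈ ({(0, 1), (0, 2), (1, 2), (1, 3), (2, 3)} : Finset (Fin 4 × Fin 4))
  asymm := by decide

/-- `(9 + √3) / 26`, the parameter of the circular graph. -/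
noncomputable def circularParam : ℝ := (9 + √3) / 26

theorem circularParam_le_half : circularParam ≤ 1 / 2 := by
  have h : √3 ≤ 4 := Real.sqrt_le_iff.mpr ⟨by norm_num, by norm_num⟩
  unfold circularParam
  linarith

/-! The upper bound is a flag-algebra certificate on five vertices. An oriented graph is encoded by
its antisymmetric signs, and c denotes (28 + 6√3)/169. For a 5-tuple of vertices, `slackAt` is 5 ·
`copyWeight` · c, minus `copyWeight` times the number of copies among the five, minus 25 terms, each
bilinear in the values of certain linear forms. Ten of these terms have a root triple and evaluate
the forms at the two remaining vertices; fifteen have a single root and evaluate them at two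
disjoint pairs. Summed over all non-root vertices, each term becomes a nonnegative combination of
squares (`sum_squareSum_nonneg`). Hence nonnegativity of `slackAt` on every tuple (`slackAt_nonneg`)
bounds the labelled density of copies by c (`sum_copiesAt_le`). A repeated vertex has sign zero with
itself, so tuples with repetitions are ordinary sign patterns and the bound holds for every n
without an error term.

Pointwise nonnegativity is a finite check over the 3^10 sign patterns, pruned by the symmetry in the
five vertices and carried out exactly in ℤ[√3].

The lower bound samples n independent points of S¹(α): the mean number of induced copies is (n
choose 4) times the density, so some sample has at least that many
(`choose_mul_density_le_maxCopies`). For the density, rotate the source v to 0. Then z = w lies in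
[α, 1 - α] and the middle vertices satisfy w - α < a < b < α, a triangle of area (α - (w - α))²/2.
As H has no nontrivial automorphism, the 4! labellings are disjoint events. The two bounds meet in
the limit because n⁴ / (4! (n choose 4)) tends to 1.

Since S¹(α) attains the bound, every square of positive weight must vanish on it; this is why
constant terms of the linear forms involve √3. -/

namespace FlagCertificate

/-! ### Data of the certificate: the squares and their weights. -/

/-- `∑ j, w j * (m * u j + c j) * (m * v j + c j)`, the list `ws` holding the pairs `(w j, c j)`. -/
def squareSum (m : ℕ) : List (ℤ√3 × ℤ√3) → List ℤ → List ℤ → ℤ√3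
  | [], _, _ => 0
  | (w, c) :: ws, u, v =>
    w * ((m * u.headD 0 + c) * (m * v.headD 0 + c)) + squareSum m ws u.tail v.tail

/-- Weights and constant terms of the squares attached to directed paths. -/
def pathWeights : List (ℤ√3 × ℤ√3) := [
  (⟨2112135527502000, 0⟩, ⟨11420, -2855⟩),
  (⟨115700918052720, 0⟩, ⟨0, 0⟩),
  (⟨3203793762449280, 0⟩, ⟨2320, -580⟩),
  (⟨129404134860, 0⟩, ⟨4000, -1000⟩),
  (⟨79557538280220, 0⟩, ⟨0, 0⟩),
  (⟨189175842835980, 0⟩, ⟨0, 0⟩),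
  (⟨921307907520, 0⟩, ⟨0, 0⟩),
  (⟨3901317960540, 0⟩, ⟨0, 0⟩),
  (⟨53247634440000000, 0⟩, ⟨4, -1⟩),
  (⟨-8153590623104692104768, 4708590306664094408272⟩, ⟨0, 0⟩),
  (⟨-2426305432730867351664, 1401216011690307596784⟩, ⟨4, -1⟩),
  (⟨-74032242021218906880, 42782168590903176344⟩, ⟨4, -1⟩),
  (⟨-8541088228318885113264, 4932096003007608993480⟩, ⟨0, 0⟩),
  (⟨14167826687460189744, -8100576279823307280⟩, ⟨0, 0⟩),
  (⟨441460039020000000, 0⟩, ⟨0, 0⟩),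
  (⟨4045581900360000000, 0⟩, ⟨0, 0⟩),
  (⟨890349980520000000, 0⟩, ⟨0, 0⟩),
  (⟨2310699671280000000, 0⟩, ⟨0, 0⟩)]

/-- Values of these squares at a further vertex with prescribed signs. -/
def pathValues : SignType → SignType → SignType → List ℤ
  | .neg, .neg, .neg =>
    [-1276, 31, 608, -1484, -5506, -8242, -976, -2421, 0, -1, 0, 0, 1, -1, -2, -3, 2, 3]
  | .neg, .neg, .zero =>
    [216, 2094, 553, -1708, 54, -851, 2512, 193, -1, 0, 0, 0, 1, -1, 2, 0, 1, 1]
  | .neg, .neg, .pos => [230, 599, -420, 1000, -572, -1000, 0, 0, -1, 0, 0, 1, 0, -1, 0, 0, 0, 0]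
  | .neg, .zero, .neg =>
    [-645, -2133, -613, -1064, 3460, 5424, 512, 2386, 0, -1, -1, 0, 1, 0, 0, 2, 1, 2]
  | .neg, .zero, .zero =>
    [-1665, 2094, -226, -2128, -978, -2414, 1024, -807, -1, 0, -1, 0, 1, 0, 0, -1, 2, 1]
  | .neg, .zero, .pos => [-415, 0, -1033, -64, 0, 0, 512, 0, -1, 0, -1, 1, 0, 0, 0, 0, 1, 0]
  | .neg, .pos, .neg =>
    [-558, 1326, -1244, 3514, 1572, 1000, -2536, 0, 0, -1, 0, 0, 1, 1, -1, 0, -3, 0]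
  | .neg, .pos, .zero => [-1000, 2326, 0, 0, 1572, 1000, 0, 0, -1, 0, 0, 0, 1, 1, 0, 0, 0, 0]
  | .neg, .pos, .pos => [230, -599, -420, 1000, 572, 1000, 0, 0, -1, 0, 0, 1, 0, 1, 0, 0, 0, 0]
  | .zero, .neg, .neg =>
    [-1230, -401, 420, -1000, -572, -1000, 0, 0, 0, -1, 0, -1, 0, -1, 0, 0, 0, 0]
  | .zero, .neg, .zero =>
    [-994, -4290, 586, -1644, -90, 2010, 2000, 1579, -1, 0, 0, -1, 0, -1, 2, 1, 0, 3]
  | .zero, .neg, .pos => [-1000, -2326, 0, 0, -1572, -1000, 0, 0, -1, 0, 0, 0, -1, -1, 0, 0, 0, 0]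
  | .zero, .zero, .neg => [-1855, -1000, -580, -1000, 0, 0, 0, 0, 0, -1, -1, -1, 0, 0, 0, 0, 0, 0]
  | .zero, .zero, .zero => [-1001, 0, -331, -1966, 0, 0, 3000, 0, -1, 0, -1, -1, 0, 0, 3, 0, 0, 0]
  | .zero, .zero, .pos =>
    [-1665, -2094, -226, -2128, 978, 2414, 1024, 807, -1, 0, -1, 0, -1, 0, 0, 1, 2, -1]
  | .zero, .pos, .neg =>
    [-592, -1000, 116, -258, -1032, -1563, 488, -1000, 0, -1, 0, -1, 0, 1, 1, -1, -1, 0]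
  | .zero, .pos, .zero =>
    [-994, 4290, 586, -1644, 90, -2010, 2000, -1579, -1, 0, 0, -1, 0, 1, 2, -1, 0, -3]
  | .zero, .pos, .pos =>
    [216, -2094, 553, -1708, -54, 851, 2512, -193, -1, 0, 0, 0, -1, 1, 2, 0, 1, -1]
  | .pos, .neg, .neg => [-230, 599, 420, -1000, -572, -1000, 0, 0, 1, 0, 0, -1, 0, -1, 0, 0, 0, 0]
  | .pos, .neg, .zero =>
    [-592, 1000, 116, -258, 1032, 1563, 488, 1000, 0, 1, 0, -1, 0, -1, 1, 1, -1, 0]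
  | .pos, .neg, .pos =>
    [-558, -1326, -1244, 3514, -1572, -1000, -2536, 0, 0, 1, 0, 0, -1, -1, -1, 0, -3, 0]
  | .pos, .zero, .neg => [-855, 0, -580, -1000, 0, 0, 0, 0, 1, 0, -1, -1, 0, 0, 0, 0, 0, 0]
  | .pos, .zero, .zero => [-1855, 1000, -580, -1000, 0, 0, 0, 0, 0, 1, -1, -1, 0, 0, 0, 0, 0, 0]
  | .pos, .zero, .pos =>
    [-645, 2133, -613, -1064, -3460, -5424, 512, -2386, 0, 1, -1, 0, -1, 0, 0, -2, 1, -2]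
  | .pos, .pos, .neg => [-230, -599, 420, -1000, 572, 1000, 0, 0, 1, 0, 0, -1, 0, 1, 0, 0, 0, 0]
  | .pos, .pos, .zero => [-1230, 401, 420, -1000, 572, 1000, 0, 0, 0, 1, 0, -1, 0, 1, 0, 0, 0, 0]
  | .pos, .pos, .pos =>
    [-1276, -31, 608, -1484, 5506, 8242, -976, 2421, 0, 1, 0, 0, -1, 1, -2, 3, 2, -3]

/-- Weights and constant terms of the squares attached to a single arc and an isolated vertex. -/
def arcWeights : List (ℤ√3 × ℤ√3) := [
  (⟨668052251586720, 0⟩, ⟨1452, -363⟩),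
  (⟨5923183887861240, 0⟩, ⟨0, 0⟩),
  (⟨19427337509580, 0⟩, ⟨2044, -511⟩),
  (⟨4383023304660, 0⟩, ⟨4000, -1000⟩),
  (⟨27080137063980, 0⟩, ⟨0, 0⟩),
  (⟨146740573980, 0⟩, ⟨0, 0⟩),
  (⟨6897426135600, 0⟩, ⟨0, 0⟩),
  (⟨23445676434180, 0⟩, ⟨0, 0⟩),
  (⟨-5741220687181463433768, 3316933976504935494344⟩, ⟨4, -1⟩),
  (⟨162838696020000000, 0⟩, ⟨0, 0⟩),
  (⟨-19216669916544466063152, 11098142457170061792408⟩, ⟨4, -1⟩),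
  (⟨3993453062282714657172, -2304743803297801334560⟩, ⟨4, -1⟩),
  (⟨39412226232357520464, -22650154046807944072⟩, ⟨0, 0⟩),
  (⟨-293370349446558255612, 169477099570950727608⟩, ⟨0, 0⟩),
  (⟨4406551329180000000, 0⟩, ⟨0, 0⟩),
  (⟨15326650499160000000, 0⟩, ⟨0, 0⟩),
  (⟨91518442955940000000, 0⟩, ⟨0, 0⟩),
  (⟨5197835943300000000, 0⟩, ⟨0, 0⟩)]

/-- Values of these squares at a further vertex with prescribed signs. -/
def arcValues : SignType → SignType → SignType → List ℤ
  | .neg, .neg, .neg =>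
    [1266, -819, -630, 2908, 1913, -1000, 0, 1422, 0, -1, 0, 0, 1, -1, 0, 2, 0, 2]
  | .neg, .neg, .zero => [445, -369, -1000, 0, 1000, 0, 0, 0, 0, -1, -1, 0, 1, 0, 0, 0, 0, 0]
  | .neg, .neg, .pos => [0, 81, 0, 0, 87, 1000, 0, 0, 0, -1, 0, 0, 1, 1, 0, 0, 0, 0]
  | .neg, .zero, .neg =>
    [-369, 524, -4309, 6818, -438, -15663, 737, 3289, -1, 0, 0, 0, 1, -1, 2, 3, -3, -1]
  | .neg, .zero, .zero =>
    [394, 60, -2471, 3522, 1955, -4621, -2421, 1711, -1, 0, -1, 0, 1, 0, -2, 2, -1, 1]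
  | .neg, .zero, .pos =>
    [-997, 681, 5991, -8046, 2089, 10842, -1158, -3867, -1, 0, 0, 0, 1, 1, -2, -3, 2, 3]
  | .neg, .pos, .neg =>
    [-1191, -450, 1508, -1682, 913, -1000, 0, -1289, -1, 0, 0, 1, 0, -1, 0, -1, 0, 1]
  | .neg, .pos, .zero => [-747, 0, -1489, 1000, 0, 0, 0, 0, -1, 0, -1, 1, 0, 0, 0, 0, 0, 0]
  | .neg, .pos, .pos =>
    [-1191, 450, 1508, -1682, -913, 1000, 0, -1289, -1, 0, 0, 1, 0, 1, 0, -1, 0, 1]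
  | .zero, .neg, .neg =>
    [-441, -622, 804, -2454, -694, 3521, 3421, -711, 0, -1, 0, -1, 0, -1, 3, -1, 1, -1]
  | .zero, .neg, .zero =>
    [637, -400, -511, -1000, -3003, -14763, 1737, 0, 0, -1, -1, -1, 0, 0, 3, 0, -3, 0]
  | .zero, .neg, .pos => [192, -550, 489, -1000, -913, 1000, 0, 0, 0, -1, 0, -1, 0, 1, 0, 0, 0, 0]
  | .zero, .zero, .neg =>
    [-808, -450, 489, -1000, 913, -1000, 0, 0, -1, 0, 0, -1, 0, -1, 0, 0, 0, 0]
  | .zero, .zero, .zero => [-680, 0, -1352, -386, 0, 0, 0, 289, -1, 0, -1, -1, 0, 0, 0, 0, 0, -1]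
  | .zero, .zero, .pos => [-808, 450, 489, -1000, -913, 1000, 0, 0, -1, 0, 0, -1, 0, 1, 0, 0, 0, 0]
  | .zero, .pos, .neg =>
    [-997, -681, 5991, -8046, -2089, -10842, 1158, -3867, -1, 0, 0, 0, -1, -1, 2, -3, -2, 3]
  | .zero, .pos, .zero =>
    [394, -60, -2471, 3522, -1955, 4621, 2421, 1711, -1, 0, -1, 0, -1, 0, 2, 2, 1, 1]
  | .zero, .pos, .pos =>
    [-369, -524, -4309, 6818, 438, 15663, -737, 3289, -1, 0, 0, 0, -1, 1, -2, 3, 3, -1]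
  | .pos, .neg, .neg => [1192, -450, 489, -1000, 913, -1000, 0, 0, 1, 0, 0, -1, 0, -1, 0, 0, 0, 0]
  | .pos, .neg, .zero => [1637, 0, -511, -1000, 0, 0, 0, 0, 1, 0, -1, -1, 0, 0, 0, 0, 0, 0]
  | .pos, .neg, .pos => [1192, 450, 489, -1000, -913, 1000, 0, 0, 1, 0, 0, -1, 0, 1, 0, 0, 0, 0]
  | .pos, .zero, .neg => [192, 550, 489, -1000, 913, -1000, 0, 0, 0, 1, 0, -1, 0, -1, 0, 0, 0, 0]
  | .pos, .zero, .zero =>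
    [637, 400, -511, -1000, 3003, 14763, -1737, 0, 0, 1, -1, -1, 0, 0, -3, 0, 3, 0]
  | .pos, .zero, .pos =>
    [-441, 622, 804, -2454, 694, -3521, -3421, -711, 0, 1, 0, -1, 0, 1, -3, -1, -1, -1]
  | .pos, .pos, .neg => [0, -81, 0, 0, -87, -1000, 0, 0, 0, 1, 0, 0, -1, -1, 0, 0, 0, 0]
  | .pos, .pos, .zero => [445, 369, -1000, 0, -1000, 0, 0, 0, 0, 1, -1, 0, -1, 0, 0, 0, 0, 0]
  | .pos, .pos, .pos => [1266, 819, -630, 2908, -1913, 1000, 0, 1422, 0, 1, 0, 0, -1, 1, 0, 2, 0, 2]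

/-- Weights and constant terms of the squares attached to two arcs with a common head. -/
def inCherryWeights : List (ℤ√3 × ℤ√3) := [
  (⟨73795594421028480, 0⟩, ⟨0, 0⟩),
  (⟨2868121913256600000000, 0⟩, ⟨0, 0⟩),
  (⟨44287527446121960000000, 0⟩, ⟨0, 0⟩)]

/-- Values of these squares at a further vertex with prescribed signs. -/
def inCherryValues : SignType → SignType → SignType → List ℤ
  | .neg, .neg, .neg => [862, 1, 2]
  | .neg, .neg, .zero => [0, 0, 0]
  | .neg, .neg, .pos => [-931, -1, -1]
  | .neg, .zero, .neg => [0, 0, 0]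
  | .neg, .zero, .zero => [-1000, -1, 0]
  | .neg, .zero, .pos => [-1000, -1, 0]
  | .neg, .pos, .neg => [-931, -1, -1]
  | .neg, .pos, .zero => [-1000, -1, 0]
  | .neg, .pos, .pos => [-1069, -1, 1]
  | .zero, .neg, .neg => [0, 0, 0]
  | .zero, .neg, .zero => [-207, 0, 3]
  | .zero, .neg, .pos => [862, 1, 2]
  | .zero, .zero, .neg => [-207, 0, 3]
  | .zero, .zero, .zero => [69, 0, -1]
  | .zero, .zero, .pos => [862, 1, 2]
  | .zero, .pos, .neg => [862, 1, 2]
  | .zero, .pos, .zero => [862, 1, 2]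
  | .zero, .pos, .pos => [1138, 1, -2]
  | .pos, .neg, .neg => [0, 0, 0]
  | .pos, .neg, .zero => [0, 0, 0]
  | .pos, .neg, .pos => [-1000, -1, 0]
  | .pos, .zero, .neg => [0, 0, 0]
  | .pos, .zero, .zero => [3069, 3, -1]
  | .pos, .zero, .pos => [-1000, -1, 0]
  | .pos, .pos, .neg => [-1000, -1, 0]
  | .pos, .pos, .zero => [-1000, -1, 0]
  | .pos, .pos, .pos => [-2069, -2, 1]

/-- Weights and constant terms of the squares attached to two arcs with a common tail. -/
def outCherryWeights : List (ℤ√3 × ℤ√3) := [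
  (⟨73795594421028480, 0⟩, ⟨0, 0⟩),
  (⟨2868121913256600000000, 0⟩, ⟨0, 0⟩),
  (⟨44287527446121960000000, 0⟩, ⟨0, 0⟩)]

/-- Values of these squares at a further vertex with prescribed signs. -/
def outCherryValues : SignType → SignType → SignType → List ℤ
  | .neg, .neg, .neg => [-2069, -2, 1]
  | .neg, .neg, .zero => [-1000, -1, 0]
  | .neg, .neg, .pos => [-1000, -1, 0]
  | .neg, .zero, .neg => [1138, 1, -2]
  | .neg, .zero, .zero => [862, 1, 2]
  | .neg, .zero, .pos => [862, 1, 2]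
  | .neg, .pos, .neg => [-1069, -1, 1]
  | .neg, .pos, .zero => [-1000, -1, 0]
  | .neg, .pos, .pos => [-931, -1, -1]
  | .zero, .neg, .neg => [-1000, -1, 0]
  | .zero, .neg, .zero => [3069, 3, -1]
  | .zero, .neg, .pos => [0, 0, 0]
  | .zero, .zero, .neg => [862, 1, 2]
  | .zero, .zero, .zero => [69, 0, -1]
  | .zero, .zero, .pos => [-207, 0, 3]
  | .zero, .pos, .neg => [-1000, -1, 0]
  | .zero, .pos, .zero => [-1000, -1, 0]
  | .zero, .pos, .pos => [0, 0, 0]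
  | .pos, .neg, .neg => [-1000, -1, 0]
  | .pos, .neg, .zero => [0, 0, 0]
  | .pos, .neg, .pos => [0, 0, 0]
  | .pos, .zero, .neg => [862, 1, 2]
  | .pos, .zero, .zero => [-207, 0, 3]
  | .pos, .zero, .pos => [0, 0, 0]
  | .pos, .pos, .neg => [-931, -1, -1]
  | .pos, .pos, .zero => [0, 0, 0]
  | .pos, .pos, .pos => [862, 1, 2]

/-- Weights and constant terms of the squares attached to directed triangles. -/
def cycleWeights : List (ℤ√3 × ℤ√3) := [
  (⟨53796208906440, 0⟩, ⟨-1000, -3000⟩),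
  (⟨3165970372075210155456, -32402305119293229120⟩, ⟨0, 0⟩),
  (⟨54321874506900000000, 0⟩, ⟨0, 0⟩),
  (⟨-75784240330065531264, 48603457678939843680⟩, ⟨-1, -3⟩),
  (⟨1937347071660000000, 0⟩, ⟨0, 0⟩)]

/-- Values of these squares at a further vertex with prescribed signs. -/
def cycleValues : SignType → SignType → SignType → List ℤ
  | .neg, .neg, .neg => [710, -3, 1, 1, 1]
  | .neg, .neg, .zero => [0, 0, 0, 0, 0]
  | .neg, .neg, .pos => [1000, -1, 0, 1, 0]
  | .neg, .zero, .neg => [0, 0, 0, 0, 0]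
  | .neg, .zero, .zero => [-1000, 0, 0, -1, 0]
  | .neg, .zero, .pos => [0, 0, 0, 0, 0]
  | .neg, .pos, .neg => [1000, -1, 0, 1, 0]
  | .neg, .pos, .zero => [0, 0, 0, 0, 0]
  | .neg, .pos, .pos => [1000, 1, 0, 1, 0]
  | .zero, .neg, .neg => [0, 0, 0, 0, 0]
  | .zero, .neg, .zero => [-1000, 0, 0, -1, 0]
  | .zero, .neg, .pos => [0, 0, 0, 0, 0]
  | .zero, .zero, .neg => [-1000, 0, 0, -1, 0]
  | .zero, .zero, .zero => [-2000, 0, 0, -2, 0]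
  | .zero, .zero, .pos => [-1000, 0, 0, -1, 0]
  | .zero, .pos, .neg => [0, 0, 0, 0, 0]
  | .zero, .pos, .zero => [-1000, 0, 0, -1, 0]
  | .zero, .pos, .pos => [0, 0, 0, 0, 0]
  | .pos, .neg, .neg => [1000, -1, 0, 1, 0]
  | .pos, .neg, .zero => [0, 0, 0, 0, 0]
  | .pos, .neg, .pos => [1000, 1, 0, 1, 0]
  | .pos, .zero, .neg => [0, 0, 0, 0, 0]
  | .pos, .zero, .zero => [-1000, 0, 0, -1, 0]
  | .pos, .zero, .pos => [0, 0, 0, 0, 0]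
  | .pos, .pos, .neg => [1000, 1, 0, 1, 0]
  | .pos, .pos, .zero => [0, 0, 0, 0, 0]
  | .pos, .pos, .pos => [710, 3, -1, 1, 1]

/-- Weights and constant terms of the squares attached to single vertices. -/
def pairWeights : List (ℤ√3 × ℤ√3) := [
  (⟨222655272840, 0⟩, ⟨0, 0⟩),
  (⟨7668381100380, 0⟩, ⟨-243440, 16400⟩),
  (⟨22971148200, 0⟩, ⟨0, 0⟩),
  (⟨3954701150400, 0⟩, ⟨-140538, -7759⟩),
  (⟨142882740, 0⟩, ⟨0, 0⟩),
  (⟨152371619400, 0⟩, ⟨108816, 12719⟩),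
  (⟨8730501780, 0⟩, ⟨0, 0⟩),
  (⟨267311624580, 0⟩, ⟨-130454, 1524⟩),
  (⟨46718992320, 0⟩, ⟨-56144, 3493⟩),
  (⟨2004022020, 0⟩, ⟨-115140, 24820⟩),
  (⟨967206240, 0⟩, ⟨-138862, 31784⟩),
  (⟨3953089140, 0⟩, ⟨-38000, 16000⟩),
  (⟨36636600000000, 0⟩, ⟨0, 0⟩),
  (⟨14988033060000000, 0⟩, ⟨0, 0⟩),
  (⟨16230013800000000, 0⟩, ⟨0, 0⟩),
  (⟨4456819027277081976, -2573033891751720110⟩, ⟨-56, -12⟩),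
  (⟨124564440000000, 0⟩, ⟨0, 0⟩),
  (⟨-5762317037766499839, 3327355533109657493⟩, ⟨-76, 32⟩),
  (⟨2744835906574782051, -1579162611994027023⟩, ⟨0, 0⟩),
  (⟨3942098160000000, 0⟩, ⟨0, 0⟩),
  (⟨13031638620000000, 0⟩, ⟨0, 0⟩),
  (⟨125936504955645384, -71898606033934680⟩, ⟨-14, -3⟩),
  (⟨-1721719024697005488, 994461521990787312⟩, ⟨-28, -6⟩),
  (⟨207800224646654640, -119831010056557800⟩, ⟨-42, -9⟩),
  (⟨6937093919886886752, -4002899552404899732⟩, ⟨-38, 16⟩),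
  (⟨31925133240000000, 0⟩, ⟨0, 0⟩)]

/-- Values of these squares at two further vertices with prescribed signs. -/
def pairValues : SignType → SignType → SignType → List ℤ
  | .neg, .neg, .neg =>
    [1000, 0, 0, 0, 0, 0, 0, 0, 0, 0, 0, 0, 1, 0, 0, 0, 0, 0, 0, 0, 0, 0, 0, 0, 0, 0]
  | .neg, .neg, .zero =>
    [2380, 1000, 1000, 0, 0, 0, 0, 0, 0, 0, 0, 0, 0, 1, 1, 0, 0, 0, 0, 0, 0, 0, 0, 0, 0, 0]
  | .neg, .neg, .pos =>
    [1000, 0, 0, 0, 0, 0, 0, 0, 0, 0, 0, 0, 1, 0, 0, 0, 0, 0, 0, 0, 0, 0, 0, 0, 0, 0]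
  | .neg, .zero, .neg =>
    [-1794, 936, -41, 1000, 1000, 0, 0, 0, 0, 0, 0, 0, 0, 0, 0, 1, 1, 0, 0, 0, 0, 0, 0, 0, 0, 0]
  | .neg, .zero, .zero =>
    [3445, 845, 108, 27, -3450, 1000, 1000, 0, 0, 0, 0, 0, 0, 0, 0, 0, 0, 1, 1, 0, 0, 0, 0, 0, 0, 0]
  | .neg, .zero, .pos =>
    [327, 756, -239, 709, -2303, -812, 195, 1000, 0, 0, 0, 0, 0, 0, 0, 0, 0, 0, 0, 1, 1, 0, 0, 0,
      0, 0]
  | .neg, .pos, .neg =>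
    [0, 269, 0, -182, 0, -3471, 0, 2751, 1000, 0, 0, 0, 0, 0, 0, 0, 0, 0, 0, 0, 0, 1, 0, 0, 0, 0]
  | .neg, .pos, .zero =>
    [0, 699, 0, 31, 0, 1952, 0, -997, -395, 1000, 0, 0, 0, 0, 0, 0, 0, 0, 0, 0, 0, 0, 1, 0, 0, 0]
  | .neg, .pos, .pos =>
    [0, 1423, 0, 1215, 0, -2338, 0, 1749, 685, 220, 1000, 0, 0, 0, 0, 0, 0, 0, 0, 0, 0, 0, 0, 1,
      0, 0]
  | .zero, .neg, .neg =>
    [327, 756, -239, 709, -2303, -812, 195, 1000, 0, 0, 0, 0, 0, 0, 0, 0, 0, 0, 0, 1, 1, 0, 0, 0,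
      0, 0]
  | .zero, .neg, .zero =>
    [3445, 845, 108, 27, -3450, 1000, 1000, 0, 0, 0, 0, 0, 0, 0, 0, 0, 0, 1, 1, 0, 0, 0, 0, 0, 0, 0]
  | .zero, .neg, .pos =>
    [-1794, 936, -41, 1000, 1000, 0, 0, 0, 0, 0, 0, 0, 0, 0, 0, 1, 1, 0, 0, 0, 0, 0, 0, 0, 0, 0]
  | .zero, .zero, .neg =>
    [0, 1150, 0, 872, 0, -2439, 0, 1221, 643, 2050, 2549, 1000, 0, 0, 0, 0, 0, 0, 0, 0, 0, 0, 0,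
      0, 1, 0]
  | .zero, .zero, .zero =>
    [0, 574, 0, 124, 0, -1308, 0, 1179, 710, 873, 161, -327, 0, 0, 0, 0, 0, 0, 0, 0, 0, 0, 0, 0,
      0, 1]
  | .zero, .zero, .pos =>
    [0, 1150, 0, 872, 0, -2439, 0, 1221, 643, 2050, 2549, 1000, 0, 0, 0, 0, 0, 0, 0, 0, 0, 0, 0,
      0, 1, 0]
  | .zero, .pos, .neg =>
    [1794, 936, 41, 1000, -1000, 0, 0, 0, 0, 0, 0, 0, 0, 0, 0, 1, -1, 0, 0, 0, 0, 0, 0, 0, 0, 0]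
  | .zero, .pos, .zero =>
    [-3445, 845, -108, 27, 3450, 1000, -1000, 0, 0, 0, 0, 0, 0, 0, 0, 0, 0, 1, -1, 0, 0, 0, 0, 0,
      0, 0]
  | .zero, .pos, .pos =>
    [-327, 756, 239, 709, 2303, -812, -195, 1000, 0, 0, 0, 0, 0, 0, 0, 0, 0, 0, 0, 1, -1, 0, 0,
      0, 0, 0]
  | .pos, .neg, .neg =>
    [0, 1423, 0, 1215, 0, -2338, 0, 1749, 685, 220, 1000, 0, 0, 0, 0, 0, 0, 0, 0, 0, 0, 0, 0, 1,
      0, 0]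
  | .pos, .neg, .zero =>
    [0, 699, 0, 31, 0, 1952, 0, -997, -395, 1000, 0, 0, 0, 0, 0, 0, 0, 0, 0, 0, 0, 0, 1, 0, 0, 0]
  | .pos, .neg, .pos =>
    [0, 269, 0, -182, 0, -3471, 0, 2751, 1000, 0, 0, 0, 0, 0, 0, 0, 0, 0, 0, 0, 0, 1, 0, 0, 0, 0]
  | .pos, .zero, .neg =>
    [-327, 756, 239, 709, 2303, -812, -195, 1000, 0, 0, 0, 0, 0, 0, 0, 0, 0, 0, 0, 1, -1, 0, 0,
      0, 0, 0]
  | .pos, .zero, .zero =>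
    [-3445, 845, -108, 27, 3450, 1000, -1000, 0, 0, 0, 0, 0, 0, 0, 0, 0, 0, 1, -1, 0, 0, 0, 0, 0,
      0, 0]
  | .pos, .zero, .pos =>
    [1794, 936, 41, 1000, -1000, 0, 0, 0, 0, 0, 0, 0, 0, 0, 0, 1, -1, 0, 0, 0, 0, 0, 0, 0, 0, 0]
  | .pos, .pos, .neg =>
    [-1000, 0, 0, 0, 0, 0, 0, 0, 0, 0, 0, 0, -1, 0, 0, 0, 0, 0, 0, 0, 0, 0, 0, 0, 0, 0]
  | .pos, .pos, .zero =>
    [-2380, 1000, -1000, 0, 0, 0, 0, 0, 0, 0, 0, 0, 0, 1, -1, 0, 0, 0, 0, 0, 0, 0, 0, 0, 0, 0]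
  | .pos, .pos, .pos =>
    [-1000, 0, 0, 0, 0, 0, 0, 0, 0, 0, 0, 0, -1, 0, 0, 0, 0, 0, 0, 0, 0, 0, 0, 0, 0, 0]

/-! ### The terms of the certificate placed on five vertices. -/

/-- The pairing `S` of the values at two further vertices, for three vertices with signs
`ab, ac, bc`. -/
def tripleTerm {R : Type*} [Zero R]
    (S : ℕ → List (ℤ√3 × ℤ√3) → List ℤ → List ℤ → R) (ab ac bc a₁ b₁ c₁ a₂ b₂ c₂ : SignType) : R :=
  match ab, ac, bc with
  -- The tables fix an order of the roots: head, tail, tail for in-cherries; sink, middle, source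
  -- for paths; head, tail, isolated vertex for arcs; head, tail, head for out-cherries; against the
  -- arcs for directed triangles. Every arm permutes its triple into that order. The factor 13, and
  -- 338 for pairs, clears denominators of the constant terms.
  | .neg, .neg, .zero => S 1 inCherryWeights (inCherryValues a₁ b₁ c₁) (inCherryValues a₂ b₂ c₂)
  | .neg, .zero, .neg => S 13 pathWeights (pathValues a₁ b₁ c₁) (pathValues a₂ b₂ c₂)
  | .neg, .zero, .zero => S 13 arcWeights (arcValues a₁ b₁ c₁) (arcValues a₂ b₂ c₂)
  | .neg, .zero, .pos => S 1 outCherryWeights (outCherryValues a₁ b₁ c₁) (outCherryValues a₂ b₂ c₂)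
  | .neg, .pos, .neg => S 13 cycleWeights (cycleValues a₁ b₁ c₁) (cycleValues a₂ b₂ c₂)
  | .neg, .pos, .zero => S 13 pathWeights (pathValues c₁ a₁ b₁) (pathValues c₂ a₂ b₂)
  | .zero, .neg, .neg => S 1 outCherryWeights (outCherryValues a₁ c₁ b₁) (outCherryValues a₂ c₂ b₂)
  | .zero, .neg, .zero => S 13 arcWeights (arcValues a₁ c₁ b₁) (arcValues a₂ c₂ b₂)
  | .zero, .neg, .pos => S 13 pathWeights (pathValues a₁ c₁ b₁) (pathValues a₂ c₂ b₂)
  | .zero, .zero, .neg => S 13 arcWeights (arcValues b₁ c₁ a₁) (arcValues b₂ c₂ a₂)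
  | .zero, .zero, .pos => S 13 arcWeights (arcValues c₁ b₁ a₁) (arcValues c₂ b₂ a₂)
  | .zero, .pos, .neg => S 13 pathWeights (pathValues b₁ c₁ a₁) (pathValues b₂ c₂ a₂)
  | .zero, .pos, .zero => S 13 arcWeights (arcValues c₁ a₁ b₁) (arcValues c₂ a₂ b₂)
  | .zero, .pos, .pos => S 1 inCherryWeights (inCherryValues c₁ a₁ b₁) (inCherryValues c₂ a₂ b₂)
  | .pos, .neg, .zero => S 13 pathWeights (pathValues b₁ a₁ c₁) (pathValues b₂ a₂ c₂)
  | .pos, .neg, .pos => S 13 cycleWeights (cycleValues a₁ c₁ b₁) (cycleValues a₂ c₂ b₂)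
  | .pos, .zero, .neg => S 1 inCherryWeights (inCherryValues b₁ a₁ c₁) (inCherryValues b₂ a₂ c₂)
  | .pos, .zero, .zero => S 13 arcWeights (arcValues b₁ a₁ c₁) (arcValues b₂ a₂ c₂)
  | .pos, .zero, .pos => S 13 pathWeights (pathValues c₁ b₁ a₁) (pathValues c₂ b₂ a₂)
  | .pos, .pos, .zero => S 1 outCherryWeights (outCherryValues b₁ a₁ c₁) (outCherryValues b₂ a₂ c₂)
  -- Transitive and empty triples carry no squares.
  | _, _, _ => 0

/-- The pairing `S` of the values at two pairs of further vertices, for a single vertex. -/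
def pairTerm {R : Type*} (S : ℕ → List (ℤ√3 × ℤ√3) → List ℤ → List ℤ → R)
    (ab ac bc ad ae de : SignType) : R :=
  S 338 pairWeights (pairValues ab ac bc) (pairValues ad ae de)

/-- Whether the six signs describe a copy with source `v`, sink `z` and middle vertices `x, y`
(in either order); the arguments are the signs of `vz, vx, vy, xz, yz, xy`. -/
def copySign : SignType → SignType → SignType → SignType → SignType → SignType → ℕ
  | .zero, .pos, .pos, .pos, .pos, .neg => 1
  | .zero, .pos, .pos, .pos, .pos, .pos => 1
  | _, _, _, _, _, _ => 0

/-- Whether four vertices with the given signs form a copy. -/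
def copyCount (ab ba ac ca ad da bc cb bd db cd dc : SignType) : ℕ :=
  copySign ab ac ad cb db cd +
  copySign ac ab ad bc dc bd +
  copySign ad ab ac bd cd bc +
  copySign ba bc bd ca da cd +
  copySign bc ba bd ac dc ad +
  copySign bd ba bc ad cd ac +
  copySign ca cb cd ba da bd +
  copySign cb ca cd ab db ad +
  copySign cd ca cb ad bd ab +
  copySign da db dc ba ca bc +
  copySign db da dc ab cb ac +
  copySign dc da db ac bc ab

/-- The number of copies among five vertices with the given signs. -/
def copyCount₅
    (ab ba ac ca ad da ae ea bc cb bd db be eb cd dc ce ec de ed : SignType) : ℕ :=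
  copyCount bc cb bd db be eb cd dc ce ec de ed +
  copyCount ac ca ad da ae ea cd dc ce ec de ed +
  copyCount ab ba ad da ae ea bd db be eb de ed +
  copyCount ab ba ac ca ae ea bc cb be eb ce ec +
  copyCount ab ba ac ca ad da bc cb bd db cd dc

/-- The values of `tripleTerm` and `pairTerm` for all ways of placing the respective
configurations on five vertices with the given signs. -/
def placements {R : Type*} [Zero R] (S : ℕ → List (ℤ√3 × ℤ√3) → List ℤ → List ℤ → R)
    (ab ba ac ca ad da ae ea bc cb bd db be eb cd dc ce ec de ed :
      SignType) : List R := [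
  tripleTerm S cd ce de ca da ea cb db eb,
  tripleTerm S bd be de ba da ea bc dc ec,
  tripleTerm S bc be ce ba ca ea bd cd ed,
  tripleTerm S bc bd cd ba ca da be ce de,
  tripleTerm S ad ae de ab db eb ac dc ec,
  tripleTerm S ac ae ce ab cb eb ad cd ed,
  tripleTerm S ac ad cd ab cb db ae ce de,
  tripleTerm S ab ae be ac bc ec ad bd ed,
  tripleTerm S ab ad bd ac bc dc ae be de,
  tripleTerm S ab ac bc ad bd cd ae be ce,
  pairTerm S ab ac bc ad ae de,
  pairTerm S ab ad bd ac ae ce,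
  pairTerm S ab ae be ac ad cd,
  pairTerm S ba bc ac bd be de,
  pairTerm S ba bd ad bc be ce,
  pairTerm S ba be ae bc bd cd,
  pairTerm S ca cb ab cd ce de,
  pairTerm S ca cd ad cb ce be,
  pairTerm S ca ce ae cb cd bd,
  pairTerm S da db ab dc de ce,
  pairTerm S da dc ac db de be,
  pairTerm S da de ae db dc bc,
  pairTerm S ea eb ab ec ed cd,
  pairTerm S ea ec ac eb ed bd,
  pairTerm S ea ed ad eb ec bc]

/-! ### Encoding of ℤ[√3] in the natural numbers. -/

/-- Half of the base of the encoding of `ℤ[√3]`. -/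
def half : ℕ := 2 ^ 159

/-- A modulus for which `2 * half` is a square root of `3`. -/
def modulus : ℕ := 4 * half ^ 2 - 3

/-- A natural number congruent to the given integer modulo `modulus`. -/
def encodeInt : ℤ → ℕ
  | .ofNat n => n
  | .negSucc n => (modulus - 1) * (n + 1)

/-- A natural number congruent to `a + b * (2 * half)` modulo `modulus`. -/
def encode (x : ℤ√3) : ℕ := encodeInt x.re + encodeInt x.im * (2 * half)

/-- A natural number encoding `squareSum`. -/
def encodedSum (m : ℕ) : List (ℤ√3 × ℤ√3) → List ℤ → List ℤ → ℕ
  | [], _, _ => 0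
  | (w, c) :: ws, u, v =>
    encode w * ((m * encodeInt (u.headD 0) + encode c) *
      (m * encodeInt (v.headD 0) + encode c)) + encodedSum m ws u.tail v.tail

/-- The remainder of `encodedSum` modulo `modulus`. -/
def encodedSumMod (m : ℕ) (ws : List (ℤ√3 × ℤ√3)) (u v : List ℤ) : ℕ :=
  encodedSum m ws u v % modulus

/-- Whether `a - half + (b - half) * √3` is nonnegative. -/
def isNonneg (a b : ℕ) : Bool :=
  if Nat.ble half a then
    Nat.ble half b || Nat.ble (3 * (half - b) ^ 2) ((a - half) ^ 2)
  else Nat.ble half b && Nat.ble ((half - a) ^ 2) (3 * (b - half) ^ 2)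

/-- The test `isNonneg` for the number encoded by `n`. -/
def isNonnegEncoded (n : ℕ) : Bool := isNonneg (n % (2 * half)) (n / (2 * half))

/-- The value that `slack` has when all other terms vanish. -/
def totalWeight : ℤ√3 := ⟨1040186347200000000000000, 222897074400000000000000⟩

/-- The weight with which each copy among five vertices is counted. -/
def copyWeight : ℕ := 1255653519120000000000000

/-- The test whether `slack` is nonnegative, carried out on the encodings. -/
def slackTest (ab ba ac ca ad da ae ea bc cb bd db be eb cd dc ce ec de ed :
    SignType) : Bool :=
  isNonnegEncoded ((half + half * (2 * half) + encode totalWeight + (modulus - 1) *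
    (copyWeight * copyCount₅ ab ba ac ca ad da ae ea bc cb bd db be eb cd dc ce ec de ed +
      (placements encodedSumMod ab ba ac ca ad da ae ea bc cb bd db be eb cd dc ce ec de ed).sum)) %
    modulus)

/-! ### The finite check over sign patterns. -/

/-- Whether `f` holds for all signs of an ordered pair and its reverse. -/
def forallSign (f : SignType → SignType → Bool) : Bool :=
  f .neg .pos && f .zero .zero && f .pos .neg

/-- The signs as digits to base three. -/
def digit : SignType → ℕ
  | .neg => 0
  | .zero => 1
  | .pos => 2

/-- A number describing the signs between four vertices. -/
def code₄ (ab ac bc ad bd cd : SignType) : ℕ :=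
  ((((digit ab * 3 + digit ac) * 3 + digit bc) * 3 + digit ad) * 3 + digit bd) * 3 + digit cd

/-- A number describing the signs between five vertices. -/
def code₅ (ab ac bc ad bd cd ae be ce de : SignType) : ℕ :=
  (((code₄ ab ac bc ad bd cd * 3 + digit ae) * 3 + digit be) * 3 + digit ce) * 3 + digit de

/-- Whether exchanging two consecutive vertices among `a, b, c, d` reduces `code₄`. -/
def improvable₄ (ab ba ac bc cb ad bd cd dc : SignType) : Bool :=
  (code₄ ba bc ac bd ad cd).blt (code₄ ab ac bc ad bd cd) ||
  (code₄ ac ab cb ad cd bd).blt (code₄ ab ac bc ad bd cd) ||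
  (code₄ ab ad bd ac bc dc).blt (code₄ ab ac bc ad bd cd)

/-- Whether the slack is nonnegative for all signs that cannot be improved by exchanging two
consecutive vertices. -/
def check : Bool :=
  forallSign fun ab ba => forallSign fun ac ca => forallSign fun bc cb =>
  forallSign fun ad da => forallSign fun bd db => forallSign fun cd dc =>
  improvable₄ ab ba ac bc cb ad bd cd dc ||
  forallSign fun ae ea => forallSign fun be eb => forallSign fun ce ec => forallSign fun de ed =>
    (code₅ ab ac bc ae be ce ad bd cd ed).blt (code₅ ab ac bc ad bd cd ae be ce de) ||
    slackTest ab ba ac ca ad da ae ea bc cb bd db be eb cd dc ce ec de ed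

/-- The kernel computes with large natural numbers natively, so each element of ℤ[√3] is packed into
a single one. Reversed signs travel as separate arguments, so no negation has to be evaluated. -/
theorem check_eq_true : check = true := by decide +kernel

/-! ### Correctness of the encoding. -/

theorem modulus_add_three : modulus + 3 = (2 * half) * (2 * half) := by decide +kernel

theorem cast_base_mul_base : ((2 * half : ℕ) : ZMod modulus) * (2 * half : ℕ) = 3 := by
  have h := congrArg (Nat.cast : ℕ → ZMod modulus) modulus_add_three
  rw [Nat.cast_add, ZMod.natCast_self, zero_add, Nat.cast_mul] at h
  exact h.symm

theorem cast_modulus_sub_one : ((modulus - 1 : ℕ) : ZMod modulus) = -1 := by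
  have h1 : modulus - 1 + 1 = modulus := by decide +kernel
  have h := congrArg (Nat.cast : ℕ → ZMod modulus) h1
  rw [Nat.cast_add, ZMod.natCast_self, Nat.cast_one] at h
  linear_combination h

/-- The reduction of `ℤ[√3]` sending `√3` to `2 * half`. -/
def reduction : ℤ√3 →+* ZMod modulus :=
  Zsqrtd.lift ⟨(2 * half : ℕ), by rw [cast_base_mul_base]; norm_num⟩

theorem reduction_apply (x : ℤ√3) :
    reduction x = (x.re : ZMod modulus) + (x.im : ZMod modulus) * (2 * half : ℕ) := rfl

theorem cast_encodeInt (z : ℤ) : (encodeInt z : ZMod modulus) = z := by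
  cases z with
  | ofNat n => simp [encodeInt]
  | negSucc n =>
    simp only [encodeInt, Int.cast_negSucc]
    rw [Nat.cast_mul, cast_modulus_sub_one]
    ring

theorem cast_encode (x : ℤ√3) : (encode x : ZMod modulus) = reduction x := by
  rw [encode, reduction_apply, Nat.cast_add, Nat.cast_mul, cast_encodeInt, cast_encodeInt]

theorem cast_encodedSum (m : ℕ) (ws : List (ℤ√3 × ℤ√3)) (u v : List ℤ) :
    (encodedSum m ws u v : ZMod modulus) = reduction (squareSum m ws u v) := by
  induction ws generalizing u v with
  | nil => simp [encodedSum, squareSum]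
  | cons p ws ih =>
    obtain ⟨w, c⟩ := p
    simp only [encodedSum, squareSum, Nat.cast_add, Nat.cast_mul, cast_encode, cast_encodeInt, ih,
      map_add, map_mul, map_natCast, map_intCast]

theorem cast_encodedSumMod (m : ℕ) (ws : List (ℤ√3 × ℤ√3)) (u v : List ℤ) :
    (encodedSumMod m ws u v : ZMod modulus) = reduction (squareSum m ws u v) := by
  rw [encodedSumMod, ← cast_encodedSum, ZMod.natCast_mod]

theorem tripleTerm_induction {R : Type*} [Zero R]
    {S : ℕ → List (ℤ√3 × ℤ√3) → List ℤ → List ℤ → R} {P : R → Prop} (zero : P 0)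
    (path : ∀ a b c d e f, P (S 13 pathWeights (pathValues a b c) (pathValues d e f)))
    (arc : ∀ a b c d e f, P (S 13 arcWeights (arcValues a b c) (arcValues d e f)))
    (inCherry : ∀ a b c d e f,
      P (S 1 inCherryWeights (inCherryValues a b c) (inCherryValues d e f)))
    (outCherry : ∀ a b c d e f,
      P (S 1 outCherryWeights (outCherryValues a b c) (outCherryValues d e f)))
    (cycle : ∀ a b c d e f, P (S 13 cycleWeights (cycleValues a b c) (cycleValues d e f)))
    (ab ac bc a₁ b₁ c₁ a₂ b₂ c₂ : SignType) :
    P (tripleTerm S ab ac bc a₁ b₁ c₁ a₂ b₂ c₂) := by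
  unfold tripleTerm
  split <;> with_reducible first
    | exact path _ _ _ _ _ _ | exact arc _ _ _ _ _ _ | exact inCherry _ _ _ _ _ _
    | exact outCherry _ _ _ _ _ _ | exact cycle _ _ _ _ _ _ | exact zero

theorem map_tripleTerm {R R' : Type*} [Zero R] [Zero R'] (f : R → R') (hf : f 0 = 0)
    (S : ℕ → List (ℤ√3 × ℤ√3) → List ℤ → List ℤ → R) (ab ac bc a₁ b₁ c₁ a₂ b₂ c₂ : SignType) :
    f (tripleTerm S ab ac bc a₁ b₁ c₁ a₂ b₂ c₂) =
      tripleTerm (fun m ws u v => f (S m ws u v)) ab ac bc a₁ b₁ c₁ a₂ b₂ c₂ := by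
  cases ab <;> cases ac <;> cases bc <;> first | rfl | exact hf

/-- Being generic in `S`, `placements` describes both the exact terms and their encodings; this
transports `reduction` and the cast through it. -/
theorem map_placements {R R' : Type*} [Zero R] [Zero R'] (f : R → R') (hf : f 0 = 0)
    (S : ℕ → List (ℤ√3 × ℤ√3) → List ℤ → List ℤ → R)
    (ab ba ac ca ad da ae ea bc cb bd db be eb cd dc ce ec de ed : SignType) :
    (placements S ab ba ac ca ad da ae ea bc cb bd db be eb cd dc ce ec de ed).map f =
      placements (fun m ws u v => f (S m ws u v))
        ab ba ac ca ad da ae ea bc cb bd db be eb cd dc ce ec de ed := by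
  simp only [placements, List.map_cons, List.map_nil, map_tripleTerm f hf, pairTerm]

/-- The exact quantity whose sign `slackTest` decides. -/
def slack (ab ba ac ca ad da ae ea bc cb bd db be eb cd dc ce ec de ed : SignType) : ℤ√3 :=
  totalWeight -
    ((copyWeight * copyCount₅ ab ba ac ca ad da ae ea bc cb bd db be eb cd dc ce ec de ed : ℕ) +
      (placements squareSum ab ba ac ca ad da ae ea bc cb bd db be eb cd dc ce ec de ed).sum)

/-- A submultiplicative norm on `ℤ[√3]`. -/
def size (x : ℤ√3) : ℤ := |x.re| + 2 * |x.im|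

theorem size_nonneg (x : ℤ√3) : 0 ≤ size x := by unfold size; positivity

theorem size_add (x y : ℤ√3) : size (x + y) ≤ size x + size y := by
  have h1 := abs_add_le x.re y.re
  have h2 := abs_add_le x.im y.im
  simp only [size, Zsqrtd.re_add, Zsqrtd.im_add]
  linarith

/-- The coefficient 2 in `size` works because the product of two imaginary parts enters the real
part with factor 3 ≤ 2². -/
theorem size_mul (x y : ℤ√3) : size (x * y) ≤ size x * size y := by
  have h1 := abs_add_le (x.re * y.re) (3 * x.im * y.im)
  have h2 := abs_add_le (x.re * y.im) (x.im * y.re)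
  simp only [abs_mul, Nat.abs_ofNat] at h1 h2
  simp only [size, Zsqrtd.re_mul, Zsqrtd.im_mul]
  have h3 : 0 ≤ |x.im| * |y.im| := by positivity
  nlinarith

/-- An upper bound for the size of `squareSum` when the values have absolute value at most `M`. -/
def majorant (m : ℕ) (M : ℤ) : List (ℤ√3 × ℤ√3) → ℤ
  | [] => 0
  | (w, c) :: ws => size w * ((m * M + size c) * (m * M + size c)) + majorant m M ws

theorem size_squareSum (m : ℕ) {M : ℤ} (hM : 0 ≤ M) (ws : List (ℤ√3 × ℤ√3)) {u v : List ℤ}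
    (hu : ∀ z ∈ u, |z| ≤ M) (hv : ∀ z ∈ v, |z| ≤ M) :
    size (squareSum m ws u v) ≤ majorant m M ws := by
  induction ws generalizing u v with
  | nil => simp [squareSum, majorant, size]
  | cons p ws ih =>
    obtain ⟨w, c⟩ := p
    have key : ∀ u : List ℤ, (∀ z ∈ u, |z| ≤ M) →
        size ((m : ℤ√3) * (u.headD 0 : ℤ) + c) ≤ m * M + size c := by
      intro u hu
      have h0 : |u.headD 0| ≤ M := by
        cases u with
        | nil => simpa using hM
        | cons a l => exact hu a (by simp)
      have h1 : size ((m : ℤ√3) * (u.headD 0 : ℤ)) = m * |u.headD 0| := by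
        simp [size, abs_mul]
      refine (size_add _ _).trans ?_
      rw [h1]
      gcongr
    have htail : ∀ u : List ℤ, (∀ z ∈ u, |z| ≤ M) → ∀ z ∈ u.tail, |z| ≤ M :=
      fun u hu z hz => hu z (List.mem_of_mem_tail hz)
    simp only [squareSum, majorant]
    refine (size_add _ _).trans (add_le_add ?_ (ih (htail u hu) (htail v hv)))
    refine (size_mul _ _).trans (mul_le_mul_of_nonneg_left ((size_mul _ _).trans ?_)
      (size_nonneg _))
    have h3 := size_nonneg c
    exact mul_le_mul (key u hu) (key v hv) (size_nonneg _) (by positivity)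

theorem abs_pathValues (a b c : SignType) : ∀ z ∈ pathValues a b c, |z| ≤ 20000 := by
  cases a <;> cases b <;> cases c <;> decide

theorem abs_arcValues (a b c : SignType) : ∀ z ∈ arcValues a b c, |z| ≤ 20000 := by
  cases a <;> cases b <;> cases c <;> decide

theorem abs_inCherryValues (a b c : SignType) : ∀ z ∈ inCherryValues a b c, |z| ≤ 20000 := by
  cases a <;> cases b <;> cases c <;> decide

theorem abs_outCherryValues (a b c : SignType) : ∀ z ∈ outCherryValues a b c, |z| ≤ 20000 := by
  cases a <;> cases b <;> cases c <;> decide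

theorem abs_cycleValues (a b c : SignType) : ∀ z ∈ cycleValues a b c, |z| ≤ 20000 := by
  cases a <;> cases b <;> cases c <;> decide

theorem abs_pairValues (a b c : SignType) : ∀ z ∈ pairValues a b c, |z| ≤ 20000 := by
  cases a <;> cases b <;> cases c <;> decide

/-- The bound 20000 exceeds every table entry. The fraction 1/64 leaves room for the 27 summands of
`slack`. -/
theorem majorant_le :
    majorant 13 20000 pathWeights ≤ half / 64 ∧ majorant 13 20000 arcWeights ≤ half / 64 ∧
    majorant 1 20000 inCherryWeights ≤ half / 64 ∧ majorant 1 20000 outCherryWeights ≤ half / 64 ∧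
    majorant 13 20000 cycleWeights ≤ half / 64 ∧ majorant 338 20000 pairWeights ≤ half / 64 := by
  decide +kernel

theorem size_tripleTerm (ab ac bc a₁ b₁ c₁ a₂ b₂ c₂ : SignType) :
    size (tripleTerm squareSum ab ac bc a₁ b₁ c₁ a₂ b₂ c₂) ≤ half / 64 := by
  obtain ⟨h1, h2, h3, h4, h5, -⟩ := majorant_le
  have hM : (0 : ℤ) ≤ 20000 := by norm_num
  refine tripleTerm_induction (P := fun x => size x ≤ (half : ℤ) / 64) (by decide +kernel)
    ?_ ?_ ?_ ?_ ?_ ab ac bc a₁ b₁ c₁ a₂ b₂ c₂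
  · exact fun a b c d e f =>
      (size_squareSum 13 hM _ (abs_pathValues a b c) (abs_pathValues d e f)).trans h1
  · exact fun a b c d e f =>
      (size_squareSum 13 hM _ (abs_arcValues a b c) (abs_arcValues d e f)).trans h2
  · exact fun a b c d e f =>
      (size_squareSum 1 hM _ (abs_inCherryValues a b c) (abs_inCherryValues d e f)).trans h3
  · exact fun a b c d e f =>
      (size_squareSum 1 hM _ (abs_outCherryValues a b c) (abs_outCherryValues d e f)).trans h4
  · exact fun a b c d e f =>
      (size_squareSum 13 hM _ (abs_cycleValues a b c) (abs_cycleValues d e f)).trans h5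

theorem size_pairTerm (ab ac bc ad ae de : SignType) :
    size (pairTerm squareSum ab ac bc ad ae de) ≤ half / 64 :=
  (size_squareSum 338 (by norm_num) _ (abs_pairValues _ _ _) (abs_pairValues _ _ _)).trans
    majorant_le.2.2.2.2.2

theorem size_list_sum {B : ℤ} (l : List (ℤ√3)) (h : ∀ x ∈ l, size x ≤ B) :
    size l.sum ≤ l.length * B := by
  induction l with
  | nil => simp [size]
  | cons a l ih =>
    have h1 := h a (by simp)
    have h2 := ih fun x hx => h x (by simp [hx])
    have h3 := size_add a l.sum
    simp only [List.sum_cons, List.length_cons]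
    push_cast
    linarith

theorem copyCount_le (ab ba ac ca ad da bc cb bd db cd dc : SignType) :
    copyCount ab ba ac ca ad da bc cb bd db cd dc ≤ 12 := by
  have h : ∀ a b c d e f, copySign a b c d e f ≤ 1 := by
    intro a b c d e f
    unfold copySign
    split <;> simp
  unfold copyCount
  linarith [h ab ac ad cb db cd, h ac ab ad bc dc bd, h ad ab ac bd cd bc, h ba bc bd ca da cd,
    h bc ba bd ac dc ad, h bd ba bc ad cd ac, h ca cb cd ba da bd, h cb ca cd ab db ad,
    h cd ca cb ad bd ab, h da db dc ba ca bc, h db da dc ab cb ac, h dc da db ac bc ab]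

theorem size_slack (ab ba ac ca ad da ae ea bc cb bd db be eb cd dc ce ec de ed : SignType) :
    size (slack ab ba ac ca ad da ae ea bc cb bd db be eb cd dc ce ec de ed) ≤ half / 2 := by
  have h1 : size (placements squareSum
      ab ba ac ca ad da ae ea bc cb bd db be eb cd dc ce ec de ed).sum ≤ 25 * (half / 64) := by
    refine size_list_sum _ ?_
    simp only [placements, List.forall_mem_cons, size_tripleTerm, size_pairTerm, true_and,
      List.not_mem_nil, false_imp_iff, implies_true]
  have h2 : copyCount₅ ab ba ac ca ad da ae ea bc cb bd db be eb cd dc ce ec de ed ≤ 60 := by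
    unfold copyCount₅
    linarith [copyCount_le bc cb bd db be eb cd dc ce ec de ed,
      copyCount_le ac ca ad da ae ea cd dc ce ec de ed,
      copyCount_le ab ba ad da ae ea bd db be eb de ed,
      copyCount_le ab ba ac ca ae ea bc cb be eb ce ec,
      copyCount_le ab ba ac ca ad da bc cb bd db cd dc]
  have h3 : ∀ n : ℕ, size (n : ℤ√3) = n := by simp [size]
  have h4 : ∀ x y : ℤ√3, size (x - y) ≤ size x + size y := by
    intro x y
    rw [sub_eq_add_neg]
    refine (size_add _ _).trans (le_of_eq ?_)
    simp [size]
  refine (h4 _ _).trans ?_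
  have h5 := (size_add ((copyWeight * copyCount₅ ab ba ac ca ad da ae ea bc cb bd db be eb cd dc
    ce ec de ed : ℕ) : ℤ√3) _).trans (add_le_add_right h1 _)
  rw [h3] at h5
  have h6 : size totalWeight ≤ half / 64 := by decide +kernel
  have h7 : copyWeight * copyCount₅ ab ba ac ca ad da ae ea bc cb bd db be eb cd dc ce ec de ed ≤
      copyWeight * 60 := Nat.mul_le_mul_left _ h2
  have h8 : ((copyWeight * copyCount₅ ab ba ac ca ad da ae ea bc cb bd db be eb cd dc ce ec de ed :
      ℕ) : ℤ) ≤ half / 64 := by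
    refine (Int.ofNat_le.mpr h7).trans ?_
    decide +kernel
  -- 25 placements, the total weight and the copies make 27 contributions.
  have h9 : (27 : ℤ) * (half / 64) ≤ half / 2 := by decide +kernel
  linarith

/-- The embedding of `ℤ[√3]` into the reals. -/
noncomputable def toReal : ℤ√3 →+* ℝ := Zsqrtd.lift ⟨√3, by norm_num⟩

theorem toReal_apply (x : ℤ√3) : toReal x = x.re + x.im * √3 := rfl

theorem nonneg_of_isNonneg {a b : ℕ} (h : isNonneg a b = true) :
    0 ≤ ((a : ℝ) - half) + ((b : ℝ) - half) * √3 := by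
  have hs : √3 * √3 = (3 : ℝ) := Real.mul_self_sqrt (by norm_num)
  have hs0 : (0 : ℝ) ≤ √3 := Real.sqrt_nonneg 3
  unfold isNonneg at h
  generalize half = k at h ⊢
  split_ifs at h with ha
  · have ha' := Nat.le_of_ble_eq_true ha
    have ha1 : (k : ℝ) ≤ a := by exact_mod_cast ha'
    rw [Bool.or_eq_true] at h
    rcases le_or_gt k b with hb | hb
    · have hb1 : (k : ℝ) ≤ b := by exact_mod_cast hb
      exact add_nonneg (by linarith) (mul_nonneg (by linarith) hs0)
    · have hb1 : (b : ℝ) ≤ k := by exact_mod_cast hb.le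
      rcases h with h | h
      · exact absurd (Nat.le_of_ble_eq_true h) (by omega)
      · have h2 : (3 : ℝ) * (k - b) ^ 2 ≤ (a - k) ^ 2 := by
          have := (Nat.cast_le (α := ℝ)).mpr (Nat.le_of_ble_eq_true h)
          rw [Nat.cast_mul, Nat.cast_pow, Nat.cast_pow, Nat.cast_sub hb.le,
            Nat.cast_sub ha'] at this
          exact_mod_cast this
        have h3 := abs_le_of_sq_le_sq' (a := ((k : ℝ) - b) * √3) (b := (a : ℝ) - k)
          (by rw [mul_pow, pow_two √3, hs]; linarith) (by linarith)
        linarith [h3.2]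
  · rw [Bool.and_eq_true] at h
    have hb := Nat.le_of_ble_eq_true h.1
    have hb1 : (k : ℝ) ≤ b := by exact_mod_cast hb
    have ha' : a ≤ k := by
      by_contra hc
      exact ha (Nat.ble_eq_true_of_le (by omega))
    have h2 : ((k : ℝ) - a) ^ 2 ≤ 3 * (b - k) ^ 2 := by
      have := (Nat.cast_le (α := ℝ)).mpr (Nat.le_of_ble_eq_true h.2)
      rw [Nat.cast_mul, Nat.cast_pow, Nat.cast_pow, Nat.cast_sub ha', Nat.cast_sub hb] at this
      exact_mod_cast this
    have h3 := abs_le_of_sq_le_sq' (a := (k : ℝ) - a) (b := ((b : ℝ) - k) * √3)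
      (by rw [mul_pow, pow_two √3, hs]; linarith) (mul_nonneg (by linarith) hs0)
    linarith [h3.2]

/-- An element of `ℤ[√3]` of small size is determined by its reduction. -/
theorem eq_of_reduction {x : ℤ√3} (hx : size x ≤ half / 2) {n : ℕ} (hn : n < modulus)
    (h : (n : ZMod modulus) = reduction x + half + half * (2 * half : ℕ)) :
    x.re = (n % (2 * half) : ℕ) - half ∧ x.im = (n / (2 * half) : ℕ) - half := by
  have h0 : (8 : ℤ) ≤ half := by decide +kernel
  have hre : |x.re| ≤ half / 2 := by
    have := abs_nonneg x.im
    unfold size at hx; linarith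
  have him : |x.im| ≤ half / 2 := by
    have := abs_nonneg x.re
    have := abs_nonneg x.im
    unfold size at hx; linarith
  rw [abs_le] at hre him
  rw [reduction_apply] at h
  have h' : ((n : ℤ) : ZMod modulus) =
      ((x.re + x.im * (2 * half : ℕ) + half + half * (2 * half : ℕ) : ℤ) : ZMod modulus) := by
    push_cast at h ⊢; exact h
  rw [ZMod.intCast_eq_intCast_iff_dvd_sub] at h'
  have hm : (modulus : ℤ) = (2 * half) * (2 * half) - 3 := by
    have := congrArg (Nat.cast : ℕ → ℤ) modulus_add_three
    push_cast at this
    linarith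
  have hn1 : (n : ℤ) < modulus := by exact_mod_cast hn
  have hn0 : (0 : ℤ) ≤ n := by positivity
  rw [hm] at h' hn1
  have hdiv := Nat.div_add_mod n (2 * half)
  have hlt := Nat.mod_lt n (show 0 < 2 * half by decide +kernel)
  generalize n / (2 * half) = q at *
  generalize n % (2 * half) = r at *
  push_cast at h'
  have hdiv' : (2 * half : ℤ) * q + r = n := by exact_mod_cast hdiv
  have hlt' : (r : ℤ) < 2 * half := by exact_mod_cast hlt
  have hr0 : (0 : ℤ) ≤ r := by positivity
  generalize (half : ℤ) = k at *
  have hk2 : 2 * (k / 2) ≤ k := by omega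
  generalize k / 2 = k₂ at *
  -- Shifted by `half`, both coordinates of `x` are digits in base `2 * half`, away from the ends of
  -- the range. So the encoded value and `n` differ by less than the modulus, and congruence becomes
  -- equality.
  have hz := Int.eq_zero_of_abs_lt_dvd h' (by
    rw [abs_lt]
    constructor <;> nlinarith)
  have hq : x.im = (q : ℤ) - k := by
    -- The right-hand side is smaller than 2k in absolute value, so the integer factor on the left
    -- is zero.
    have e1 : 2 * k * (x.im - (q - k)) = (r : ℤ) - k - x.re := by linarith
    have e2 : x.im - (q - k) < 1 := by nlinarith
    have e3 : -1 < x.im - (q - k) := by nlinarith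
    omega
  refine ⟨?_, hq⟩
  rw [hq] at hz
  linarith

theorem slack_nonneg_of_slackTest
    (ab ba ac ca ad da ae ea bc cb bd db be eb cd dc ce ec de ed : SignType)
    (h : slackTest ab ba ac ca ad da ae ea bc cb bd db be eb cd dc ce ec de ed = true) :
    0 ≤ toReal (slack ab ba ac ca ad da ae ea bc cb bd db be eb cd dc ce ec de ed) := by
  have hs := size_slack ab ba ac ca ad da ae ea bc cb bd db be eb cd dc ce ec de ed
  have hp : (((placements encodedSumMod ab ba ac ca ad da ae ea bc cb bd db be eb cd dc ce ec
      de ed).sum : ℕ) : ZMod modulus) = reduction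
      (placements squareSum ab ba ac ca ad da ae ea bc cb bd db be eb cd dc ce ec de ed).sum := by
    rw [map_list_sum, map_placements reduction (map_zero _), Nat.cast_list_sum,
      map_placements (Nat.cast : ℕ → ZMod modulus) Nat.cast_zero]
    simp only [cast_encodedSumMod]
  unfold slackTest isNonnegEncoded at h
  obtain ⟨h1, h2⟩ := eq_of_reduction hs
    (n := (half + half * (2 * half) + encode totalWeight + (modulus - 1) *
    (copyWeight * copyCount₅ ab ba ac ca ad da ae ea bc cb bd db be eb cd dc ce ec de ed +
      (placements encodedSumMod ab ba ac ca ad da ae ea bc cb bd db be eb cd dc ce ec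
      de ed).sum)) % modulus) (Nat.mod_lt _ (by decide +kernel)) (by
      rw [ZMod.natCast_mod]
      rw [Nat.cast_add, Nat.cast_add, Nat.cast_add, Nat.cast_mul, Nat.cast_mul (modulus - 1),
        cast_modulus_sub_one, Nat.cast_add, hp, cast_encode, slack, map_sub, map_add, map_natCast]
      ring)
  have h3 := nonneg_of_isNonneg h
  rw [toReal_apply, h1, h2, Int.cast_sub, Int.cast_sub, Int.cast_natCast, Int.cast_natCast,
    Int.cast_natCast]
  exact h3

/-! ### Symmetry of the slack in the five vertices. -/

theorem squareSum_comm (m : ℕ) (ws : List (ℤ√3 × ℤ√3)) (u v : List ℤ) :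
    squareSum m ws u v = squareSum m ws v u := by
  induction ws generalizing u v with
  | nil => rfl
  | cons p ws ih =>
    obtain ⟨w, c⟩ := p
    simp only [squareSum, ih u.tail v.tail, mul_comm ((m : ℤ√3) * (u.headD 0 : ℤ) + c)]

theorem inCherryValues_comm (a b c : SignType) : inCherryValues a c b = inCherryValues a b c := by
  cases a <;> cases b <;> cases c <;> rfl

theorem outCherryValues_comm (a b c : SignType) :
    outCherryValues c b a = outCherryValues a b c := by
  cases a <;> cases b <;> cases c <;> rfl

theorem cycleValues_rotate (a b c : SignType) : cycleValues b c a = cycleValues a b c := by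
  cases a <;> cases b <;> cases c <;> rfl

theorem pairValues_comm (a b c : SignType) : pairValues b a (-c) = pairValues a b c := by
  cases a <;> cases b <;> cases c <;> rfl

/-- For most sign patterns both sides read the same table at the same arguments. Only triples with a
symmetry of their own need the invariance of their table. -/
theorem tripleTerm_swap_left {R : Type*} [Zero R]
    (S : ℕ → List (ℤ√3 × ℤ√3) → List ℤ → List ℤ → R)
    (ab ac bc a₁ b₁ c₁ a₂ b₂ c₂ : SignType) :
    tripleTerm S (-ab) bc ac b₁ a₁ c₁ b₂ a₂ c₂ = tripleTerm S ab ac bc a₁ b₁ c₁ a₂ b₂ c₂ := by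
  cases ab <;> cases ac <;> cases bc <;> first
    | rfl
    | exact congrArg₂ (S 1 inCherryWeights) (inCherryValues_comm ..) (inCherryValues_comm ..)
    | exact congrArg₂ (S 1 outCherryWeights) (outCherryValues_comm ..) (outCherryValues_comm ..)
    | exact congrArg₂ (S 13 cycleWeights) (cycleValues_rotate ..) (cycleValues_rotate ..)
    | exact congrArg₂ (S 13 cycleWeights) (cycleValues_rotate ..).symm (cycleValues_rotate ..).symm

theorem tripleTerm_swap_right {R : Type*} [Zero R]
    (S : ℕ → List (ℤ√3 × ℤ√3) → List ℤ → List ℤ → R)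
    (ab ac bc a₁ b₁ c₁ a₂ b₂ c₂ : SignType) :
    tripleTerm S ac ab (-bc) a₁ c₁ b₁ a₂ c₂ b₂ = tripleTerm S ab ac bc a₁ b₁ c₁ a₂ b₂ c₂ := by
  cases ab <;> cases ac <;> cases bc <;> first
    | rfl
    | exact congrArg₂ (S 1 inCherryWeights) (inCherryValues_comm ..) (inCherryValues_comm ..)
    | exact congrArg₂ (S 1 outCherryWeights) (outCherryValues_comm ..) (outCherryValues_comm ..)

theorem tripleTerm_flip {R : Type*} [Zero R]
    (S : ℕ → List (ℤ√3 × ℤ√3) → List ℤ → List ℤ → R)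
    (ab ac bc a₁ b₁ c₁ a₂ b₂ c₂ : SignType) :
    tripleTerm (fun m ws u v => S m ws v u) ab ac bc a₁ b₁ c₁ a₂ b₂ c₂ =
      tripleTerm S ab ac bc a₂ b₂ c₂ a₁ b₁ c₁ := by
  cases ab <;> cases ac <;> cases bc <;> rfl

/-- The pairing at `x, y` of the squares attached to `a, b, c`. -/
def tripleAt {V : Type*} (s : V → V → SignType) (a b c x y : V) : ℤ√3 :=
  tripleTerm squareSum (s a b) (s a c) (s b c) (s a x) (s b x) (s c x) (s a y) (s b y) (s c y)

/-- The pairing at `x, y` and `z, w` of the squares attached to `v`. -/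
def pairAt {V : Type*} (s : V → V → SignType) (v x y z w : V) : ℤ√3 :=
  pairTerm squareSum (s v x) (s v y) (s x y) (s v z) (s v w) (s z w)

/-- Indicator of a copy with source `v`, sink `z` and middle vertices `x, y` in either order. -/
def copyAt {V : Type*} (s : V → V → SignType) (v z x y : V) : ℕ :=
  copySign (s v z) (s v x) (s v y) (s x z) (s y z) (s x y)

/-- Indicator of a copy on four vertices. -/
def copiesAt {V : Type*} (s : V → V → SignType) (a b c d : V) : ℕ :=
    copyAt s a b c d + copyAt s a c b d + copyAt s a d b c + copyAt s b a c d +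
    copyAt s b c a d + copyAt s b d a c + copyAt s c a b d + copyAt s c b a d +
    copyAt s c d a b + copyAt s d a b c + copyAt s d b a c + copyAt s d c a b

def slackAt {V : Type*} (s : V → V → SignType) (a b c d e : V) : ℤ√3 :=
  totalWeight - ((copyWeight * (
      copiesAt s b c d e + copiesAt s a c d e + copiesAt s a b d e + copiesAt s a b c e +
      copiesAt s a b c d : ℕ) : ℕ) +
    List.sum [
    tripleAt s c d e a b, tripleAt s b d e a c, tripleAt s b c e a d, tripleAt s b c d a e,
    tripleAt s a d e b c, tripleAt s a c e b d, tripleAt s a c d b e, tripleAt s a b e c d,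
    tripleAt s a b d c e, tripleAt s a b c d e, pairAt s a b c d e, pairAt s a b d c e,
    pairAt s a b e c d, pairAt s b a c d e, pairAt s b a d c e, pairAt s b a e c d,
    pairAt s c a b d e, pairAt s c a d b e, pairAt s c a e b d, pairAt s d a b c e,
    pairAt s d a c b e, pairAt s d a e b c, pairAt s e a b c d, pairAt s e a c b d,
    pairAt s e a d b c])

theorem slackAt_eq {V : Type*} (s : V → V → SignType) (a b c d e : V) : slackAt s a b c d e =
    slack (s a b) (s b a) (s a c) (s c a) (s a d) (s d a) (s a e) (s e a) (s b c) (s c b) (s b d)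
      (s d b) (s b e) (s e b) (s c d) (s d c) (s c e) (s e c) (s d e) (s e d) := rfl

theorem tripleAt_swap_left {V : Type*} {s : V → V → SignType} (hs : ∀ a b, s b a = -s a b)
    (a b c x y : V) : tripleAt s b a c x y = tripleAt s a b c x y := by
  unfold tripleAt
  rw [hs a b, tripleTerm_swap_left]

theorem tripleAt_swap_right {V : Type*} {s : V → V → SignType} (hs : ∀ a b, s b a = -s a b)
    (a b c x y : V) : tripleAt s a c b x y = tripleAt s a b c x y := by
  unfold tripleAt
  rw [hs b c, tripleTerm_swap_right]

theorem tripleAt_comm {V : Type*} (s : V → V → SignType) (a b c x y : V) :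
    tripleAt s a b c y x = tripleAt s a b c x y := by
  have h : (fun m ws u v => squareSum m ws v u) = squareSum := by
    funext m ws u v
    exact squareSum_comm m ws v u
  unfold tripleAt
  rw [← tripleTerm_flip, h]

theorem pairAt_swap_left {V : Type*} {s : V → V → SignType} (hs : ∀ a b, s b a = -s a b)
    (v x y z w : V) : pairAt s v y x z w = pairAt s v x y z w := by
  unfold pairAt pairTerm
  rw [hs x y, pairValues_comm]

theorem pairAt_swap_right {V : Type*} {s : V → V → SignType} (hs : ∀ a b, s b a = -s a b)
    (v x y z w : V) : pairAt s v x y w z = pairAt s v x y z w := by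
  unfold pairAt pairTerm
  rw [hs z w, pairValues_comm]

theorem pairAt_comm {V : Type*} (s : V → V → SignType) (v x y z w : V) :
    pairAt s v z w x y = pairAt s v x y z w :=
  squareSum_comm _ _ _ _

theorem copyAt_comm {V : Type*} {s : V → V → SignType} (hs : ∀ a b, s b a = -s a b)
    (v z x y : V) : copyAt s v z y x = copyAt s v z x y := by
  unfold copyAt
  rw [hs x y]
  generalize s v z = a, s v x = b, s v y = c, s x z = d, s y z = e, s x y = f
  revert a b c d e f
  decide

/-- An exchange of vertices merely permutes the five 4-subsets and the 25 placements. Adjacent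
exchanges suffice for the descent below. -/
theorem slackAt_swap₁ {V : Type*} {s : V → V → SignType} (hs : ∀ a b, s b a = -s a b)
    (a b c d e : V) : slackAt s b a c d e = slackAt s a b c d e := by
  simp only [slackAt, copiesAt, List.sum_cons, List.sum_nil]
  simp only [tripleAt_swap_left hs a b, tripleAt_comm s _ _ _ a b, pairAt_swap_left hs _ a b,
    pairAt_comm s _ a _ b _, copyAt_comm hs _ _ a b]
  push_cast
  ring

theorem slackAt_swap₂ {V : Type*} {s : V → V → SignType} (hs : ∀ a b, s b a = -s a b)
    (a b c d e : V) : slackAt s a c b d e = slackAt s a b c d e := by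
  simp only [slackAt, copiesAt, List.sum_cons, List.sum_nil]
  simp only [tripleAt_swap_left hs b c, tripleAt_swap_right hs _ b c, tripleAt_comm s _ _ _ b c,
    pairAt_swap_left hs _ b c, pairAt_swap_right hs _ _ _ b c, pairAt_comm s _ b _ c _,
    copyAt_comm hs _ _ b c]
  push_cast
  ring

theorem slackAt_swap₃ {V : Type*} {s : V → V → SignType} (hs : ∀ a b, s b a = -s a b)
    (a b c d e : V) : slackAt s a b d c e = slackAt s a b c d e := by
  simp only [slackAt, copiesAt, List.sum_cons, List.sum_nil]
  simp only [tripleAt_swap_left hs c d, tripleAt_swap_right hs _ c d, tripleAt_comm s _ _ _ c d,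
    pairAt_swap_right hs _ _ _ c d, copyAt_comm hs _ _ c d]
  push_cast
  ring

theorem slackAt_swap₄ {V : Type*} {s : V → V → SignType} (hs : ∀ a b, s b a = -s a b)
    (a b c d e : V) : slackAt s a b c e d = slackAt s a b c d e := by
  simp only [slackAt, copiesAt, List.sum_cons, List.sum_nil]
  simp only [tripleAt_swap_right hs _ d e, tripleAt_comm s _ _ _ d e,
    pairAt_swap_right hs _ _ _ d e, copyAt_comm hs _ _ d e]
  push_cast
  ring

/-! ### From the finite check to pointwise nonnegativity. -/

theorem forallSign_eq_true {f : SignType → SignType → Bool} (h : forallSign f = true)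
    (x : SignType) : f x (-x) = true := by
  unfold forallSign at h
  simp only [Bool.and_eq_true] at h
  cases x
  · exact h.1.2
  · exact h.1.1
  · exact h.2

theorem digit_le (x : SignType) : digit x ≤ 2 := by cases x <;> decide

/-- The signs among the first four vertices are the leading digits, so patterns can be discarded
before the fifth vertex is enumerated. -/
theorem code₅_lt_of_code₄_lt {ab ac bc ad bd cd ab' ac' bc' ad' bd' cd' : SignType}
    (h : code₄ ab' ac' bc' ad' bd' cd' < code₄ ab ac bc ad bd cd)
    (ae be ce de ae' be' ce' de' : SignType) :
    code₅ ab' ac' bc' ad' bd' cd' ae' be' ce' de' < code₅ ab ac bc ad bd cd ae be ce de := by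
  have h1 := digit_le ae'
  have h2 := digit_le be'
  have h3 := digit_le ce'
  have h4 := digit_le de'
  unfold code₅
  omega

/-- `code₅` of the signs between five vertices. -/
def codeAt {V : Type*} (s : V → V → SignType) (a b c d e : V) : ℕ :=
  code₅ (s a b) (s a c) (s b c) (s a d) (s b d) (s c d) (s a e) (s b e) (s c e) (s d e)

theorem slackAt_nonneg_or_codeAt_lt {V : Type*} {s : V → V → SignType}
    (hs : ∀ a b, s b a = -s a b) (a b c d e : V) :
    0 ≤ toReal (slackAt s a b c d e) ∨ codeAt s b a c d e < codeAt s a b c d e ∨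
      codeAt s a c b d e < codeAt s a b c d e ∨ codeAt s a b d c e < codeAt s a b c d e ∨
      codeAt s a b c e d < codeAt s a b c d e := by
  have h := check_eq_true
  unfold check at h
  have h := forallSign_eq_true h (s a b)
  have h := forallSign_eq_true h (s a c)
  have h := forallSign_eq_true h (s b c)
  have h := forallSign_eq_true h (s a d)
  have h := forallSign_eq_true h (s b d)
  have h := forallSign_eq_true h (s c d)
  rw [Bool.or_eq_true] at h
  rcases h with h | h
  · unfold improvable₄ at h
    simp only [Bool.or_eq_true, Nat.blt_eq, ← hs] at h
    rcases h with (h | h) | h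
    · exact .inr (.inl (code₅_lt_of_code₄_lt h ..))
    · exact .inr (.inr (.inl (code₅_lt_of_code₄_lt h ..)))
    · exact .inr (.inr (.inr (.inl (code₅_lt_of_code₄_lt h ..))))
  · have h := forallSign_eq_true h (s a e)
    have h := forallSign_eq_true h (s b e)
    have h := forallSign_eq_true h (s c e)
    have h := forallSign_eq_true h (s d e)
    simp only [Bool.or_eq_true, Nat.blt_eq, ← hs] at h
    rcases h with h | h
    · exact .inr (.inr (.inr (.inr h)))
    · left
      rw [slackAt_eq]
      exact slack_nonneg_of_slackTest _ _ _ _ _ _ _ _ _ _ _ _ _ _ _ _ _ _ _ _ h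

/-- Descent on `codeAt`: an adjacent exchange that lowers the code leaves the slack unchanged, and a
pattern admitting none was tested directly. -/
theorem slackAt_nonneg {V : Type*} {s : V → V → SignType} (hs : ∀ a b, s b a = -s a b)
    (a b c d e : V) : 0 ≤ toReal (slackAt s a b c d e) := by
  induction h : codeAt s a b c d e using Nat.strong_induction_on generalizing a b c d e with
  | _ n ih =>
    subst h
    rcases slackAt_nonneg_or_codeAt_lt hs a b c d e with h | h | h | h | h
    · exact h
    · rw [← slackAt_swap₁ hs]; exact ih _ h _ _ _ _ _ rfl
    · rw [← slackAt_swap₂ hs]; exact ih _ h _ _ _ _ _ rfl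
    · rw [← slackAt_swap₃ hs]; exact ih _ h _ _ _ _ _ rfl
    · rw [← slackAt_swap₄ hs]; exact ih _ h _ _ _ _ _ rfl

/-! ### Averaging: the upper bound for labelled copies. -/

/-- For each weight the double sum factors as w · (∑ₓ (m·u(x) + c))². -/
theorem sum_squareSum_nonneg {X : Type*} [Fintype X] (m : ℕ) {ws : List (ℤ√3 × ℤ√3)}
    (hw : ∀ p ∈ ws, 0 ≤ toReal p.1) (u : X → List ℤ) :
    0 ≤ ∑ x, ∑ y, toReal (squareSum m ws (u x) (u y)) := by
  induction ws generalizing u with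
  | nil => simp [squareSum]
  | cons p ws ih =>
    obtain ⟨w, c⟩ := p
    have h1 := ih (fun p hp => hw p (by simp [hp])) fun x => (u x).tail
    have h2 : 0 ≤ toReal w := hw (w, c) (by simp)
    have h3 : ∑ x, ∑ y, toReal (squareSum m ((w, c) :: ws) (u x) (u y)) =
        toReal w * (∑ x, toReal (m * ((u x).headD 0 : ℤ) + c)) ^ 2 +
          ∑ x, ∑ y, toReal (squareSum m ws (u x).tail (u y).tail) := by
      rw [pow_two, Finset.sum_mul_sum, Finset.mul_sum, ← Finset.sum_add_distrib]
      refine Finset.sum_congr rfl fun x _ => ?_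
      rw [Finset.mul_sum, ← Finset.sum_add_distrib]
      refine Finset.sum_congr rfl fun y _ => ?_
      rw [squareSum, map_add, map_mul, map_mul]
    rw [h3]
    positivity

/-- Shifting by `half` makes both coordinates natural numbers, so the integer test `isNonneg`
applies to the weights too. -/
theorem weights_nonneg_of_isNonneg {ws : List (ℤ√3 × ℤ√3)}
    (h : ∀ p ∈ ws, 0 ≤ p.1.re + half ∧ 0 ≤ p.1.im + half ∧
      isNonneg (p.1.re + half).toNat (p.1.im + half).toNat = true) :
    ∀ p ∈ ws, 0 ≤ toReal p.1 := by
  intro p hp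
  obtain ⟨h1, h2, h3⟩ := h p hp
  have h4 := nonneg_of_isNonneg h3
  rw [← Int.cast_natCast (p.1.re + half).toNat, ← Int.cast_natCast (p.1.im + half).toNat,
    Int.toNat_of_nonneg h1, Int.toNat_of_nonneg h2, Int.cast_add, Int.cast_add] at h4
  rw [toReal_apply]
  simpa using h4

theorem pathWeights_nonneg : ∀ p ∈ pathWeights, 0 ≤ toReal p.1 :=
  weights_nonneg_of_isNonneg (by decide +kernel)

theorem arcWeights_nonneg : ∀ p ∈ arcWeights, 0 ≤ toReal p.1 :=
  weights_nonneg_of_isNonneg (by decide +kernel)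

theorem inCherryWeights_nonneg : ∀ p ∈ inCherryWeights, 0 ≤ toReal p.1 :=
  weights_nonneg_of_isNonneg (by decide +kernel)

theorem outCherryWeights_nonneg : ∀ p ∈ outCherryWeights, 0 ≤ toReal p.1 :=
  weights_nonneg_of_isNonneg (by decide +kernel)

theorem cycleWeights_nonneg : ∀ p ∈ cycleWeights, 0 ≤ toReal p.1 :=
  weights_nonneg_of_isNonneg (by decide +kernel)

theorem pairWeights_nonneg : ∀ p ∈ pairWeights, 0 ≤ toReal p.1 :=
  weights_nonneg_of_isNonneg (by decide +kernel)

theorem sum_tripleTerm_nonneg {X : Type*} [Fintype X] (ab ac bc : SignType)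
    (f g h : X → SignType) :
    0 ≤ ∑ x, ∑ y, toReal (tripleTerm squareSum ab ac bc (f x) (g x) (h x) (f y) (g y) (h y)) := by
  cases ab <;> cases ac <;> cases bc <;> simp only [tripleTerm] <;> with_reducible first
    | exact sum_squareSum_nonneg 13 pathWeights_nonneg _
    | exact sum_squareSum_nonneg 13 arcWeights_nonneg _
    | exact sum_squareSum_nonneg 1 inCherryWeights_nonneg _
    | exact sum_squareSum_nonneg 1 outCherryWeights_nonneg _
    | exact sum_squareSum_nonneg 13 cycleWeights_nonneg _
    | simp

theorem sum_fin_succ {V : Type*} [Fintype V] {n : ℕ} (g : (Fin (n + 1) → V) → ℝ) :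
    ∑ u, g u = ∑ a, ∑ u : Fin n → V, g (Fin.cons a u) := by
  rw [← (Fin.consEquiv fun _ => V).sum_comp, Fintype.sum_prod_type]
  rfl

theorem sum_fin_five {V : Type*} [Fintype V] (g : V → V → V → V → V → ℝ) :
    ∑ u : Fin 5 → V, g (u 0) (u 1) (u 2) (u 3) (u 4) = ∑ a, ∑ b, ∑ c, ∑ d, ∑ e, g a b c d e := by
  simp only [sum_fin_succ, Fintype.sum_unique]
  rfl

theorem sum_fin_five_comp {V : Type*} [Fintype V] (i : Fin 5 → Fin 5)
    (hi : Function.Bijective i) (g : V → V → V → V → V → ℝ) :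
    ∑ u : Fin 5 → V, g (u (i 0)) (u (i 1)) (u (i 2)) (u (i 3)) (u (i 4)) =
      ∑ a, ∑ b, ∑ c, ∑ d, ∑ e, g a b c d e := by
  rw [← sum_fin_five]
  exact ((Equiv.ofBijective i hi).arrowCongr (Equiv.refl V)).symm.sum_comp
    fun u => g (u 0) (u 1) (u 2) (u 3) (u 4)

theorem toReal_totalWeight : toReal totalWeight = 5 * copyWeight * ((28 + 6 * √3) / 169) := by
  rw [toReal_apply, totalWeight, copyWeight]
  push_cast
  ring

/-- In any oriented graph the density of labelled copies is at most `(28 + 6√3) / 169`. -/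
theorem sum_copiesAt_le {V : Type*} [Fintype V] {s : V → V → SignType}
    (hs : ∀ a b, s b a = -s a b) :
    ∑ a, ∑ b, ∑ c, ∑ d, (copiesAt s a b c d : ℝ) ≤
      (28 + 6 * √3) / 169 * (Fintype.card V : ℝ) ^ 4 := by
  rcases isEmpty_or_nonempty V with hV | hV
  · simp
  have hT : ∀ i j k l m : Fin 5, Function.Bijective ![i, j, k, l, m] → 0 ≤ ∑ u : Fin 5 → V,
      toReal (tripleAt s (u i) (u j) (u k) (u l) (u m)) := by
    intro i j k l m hi
    refine le_of_le_of_eq ?_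
      (sum_fin_five_comp _ hi fun a b c d e => toReal (tripleAt s a b c d e)).symm
    exact Finset.sum_nonneg fun a _ => Finset.sum_nonneg fun b _ => Finset.sum_nonneg fun c _ =>
      sum_tripleTerm_nonneg ..
  have hP : ∀ i j k l m : Fin 5, Function.Bijective ![i, j, k, l, m] → 0 ≤ ∑ u : Fin 5 → V,
      toReal (pairAt s (u i) (u j) (u k) (u l) (u m)) := by
    intro i j k l m hi
    refine le_of_le_of_eq ?_
      (sum_fin_five_comp _ hi fun a b c d e => toReal (pairAt s a b c d e)).symm
    refine Finset.sum_nonneg fun a _ => ?_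
    -- With one root, the index set of the square is the set of ordered pairs of further vertices.
    have := sum_squareSum_nonneg 338 pairWeights_nonneg fun x : V × V =>
      pairValues (s a x.1) (s a x.2) (s x.1 x.2)
    simp only [Fintype.sum_prod_type] at this
    exact this
  have hC : ∀ i j k l m : Fin 5, Function.Bijective ![i, j, k, l, m] → ∑ u : Fin 5 → V,
      (copiesAt s (u j) (u k) (u l) (u m) : ℝ) =
        Fintype.card V * ∑ a, ∑ b, ∑ c, ∑ d, (copiesAt s a b c d : ℝ) := by
    intro i j k l m hi
    refine (sum_fin_five_comp _ hi fun _ b c d e => (copiesAt s b c d e : ℝ)).trans ?_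
    rw [Finset.sum_const,
      Finset.card_univ, nsmul_eq_mul]
  have h : 0 ≤ ∑ u : Fin 5 → V, toReal (slackAt s (u 0) (u 1) (u 2) (u 3) (u 4)) :=
    Finset.sum_nonneg fun u _ => slackAt_nonneg hs _ _ _ _ _
  simp only [slackAt, List.sum_cons, List.sum_nil, map_sub, map_add, map_zero, map_mul, map_natCast,
    Nat.cast_mul, Nat.cast_add, Finset.sum_sub_distrib, Finset.sum_add_distrib, ← Finset.mul_sum,
    Finset.sum_const, Finset.card_univ, Fintype.card_fun, Fintype.card_fin, nsmul_eq_mul,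
    toReal_totalWeight] at h
  have hc : (0 : ℝ) < copyWeight := by norm_num [copyWeight]
  have hn : (0 : ℝ) < Fintype.card V := by exact_mod_cast Fintype.card_pos
  refine le_of_mul_le_mul_left ?_ (show (0 : ℝ) < 5 * copyWeight * Fintype.card V by positivity)
  push_cast at h
  -- The first index is the vertex left out of the 4-subset; its free summation gives the factor
  -- |V|.
  rw [hC 0 1 2 3 4 (by decide), hC 1 0 2 3 4 (by decide), hC 2 0 1 3 4 (by decide),
    hC 3 0 1 2 4 (by decide), hC 4 0 1 2 3 (by decide)] at h
  linarith [
    hT 2 3 4 0 1 (by decide), hT 1 3 4 0 2 (by decide), hT 1 2 4 0 3 (by decide),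
    hT 1 2 3 0 4 (by decide), hT 0 3 4 1 2 (by decide), hT 0 2 4 1 3 (by decide),
    hT 0 2 3 1 4 (by decide), hT 0 1 4 2 3 (by decide), hT 0 1 3 2 4 (by decide),
    hT 0 1 2 3 4 (by decide), hP 0 1 2 3 4 (by decide), hP 0 1 3 2 4 (by decide),
    hP 0 1 4 2 3 (by decide), hP 1 0 2 3 4 (by decide), hP 1 0 3 2 4 (by decide),
    hP 1 0 4 2 3 (by decide), hP 2 0 1 3 4 (by decide), hP 2 0 3 1 4 (by decide),
    hP 2 0 4 1 3 (by decide), hP 3 0 1 2 4 (by decide), hP 3 0 2 1 4 (by decide),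
    hP 3 0 4 1 2 (by decide), hP 4 0 1 2 3 (by decide), hP 4 0 2 1 3 (by decide),
    hP 4 0 3 1 2 (by decide)]

end FlagCertificate

/-! ### From labelled copies to numbers of copies. -/

namespace OrientedGraph

open Classical in
/-- The sign of a pair of vertices: positive for an arc, negative for a reversed arc. -/
noncomputable def sign {V : Type*} (G : OrientedGraph V) (a b : V) : SignType :=
  if G.Adj a b then .pos else if G.Adj b a then .neg else .zero

theorem sign_antisymm {V : Type*} (G : OrientedGraph V) (a b : V) : G.sign b a = -G.sign a b := by
  have h := G.asymm a b
  have h' := G.asymm b a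
  unfold sign
  split_ifs with h1 h2 h3 <;> first | rfl | exact absurd h2 (h' h1)

theorem sign_comp_of_forall_adj_iff {V W : Type*} {G : OrientedGraph V} {H : OrientedGraph W}
    {f : W → V} (hf : ∀ i j, G.Adj (f i) (f j) ↔ H.Adj i j) :
    (fun i j => G.sign (f i) (f j)) = H.sign := by
  funext i j
  unfold sign
  split_ifs <;> simp_all

/-- `sign` is defined classically; this form can be evaluated by `decide`. -/
theorem sign_transitiveMinusArc : transitiveMinusArc.sign = fun i j : Fin 4 =>
    if i < j ∧ ¬ (i = 0 ∧ j = 3) then SignType.pos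
    else if j < i ∧ ¬ (j = 0 ∧ i = 3) then SignType.neg else .zero := by
  have h : ∀ i j : Fin 4, transitiveMinusArc.Adj i j ↔ i < j ∧ ¬ (i = 0 ∧ j = 3) := by
    intro i j
    unfold transitiveMinusArc
    revert i j
    decide
  funext i j
  simp only [sign, h]

theorem copiesAt_transitiveMinusArc (σ : Equiv.Perm (Fin 4)) :
    FlagCertificate.copiesAt transitiveMinusArc.sign (σ 0) (σ 1) (σ 2) (σ 3) = 1 := by
  rw [sign_transitiveMinusArc]
  revert σ
  decide +kernel

theorem InducesCopy.exists_range_eq {V W : Type*} {H : OrientedGraph W} {G : OrientedGraph V}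
    {S : Set V} (h : InducesCopy H G S) :
    ∃ f : W → V, Function.Injective f ∧ Set.range f = S ∧
      ∀ i j, G.Adj (f i) (f j) ↔ H.Adj i j := by
  obtain ⟨e⟩ := h
  refine ⟨fun i => (e.symm i : V), Subtype.val_injective.comp e.symm.injective, ?_, fun i j => ?_⟩
  · ext x
    constructor
    · rintro ⟨i, rfl⟩
      exact (e.symm i).2
    · intro hx
      exact ⟨e ⟨x, hx⟩, by simp⟩
  · exact e.symm.map_rel_iff (a := i) (b := j)

theorem inducesCopy_range {V W : Type*} {H : OrientedGraph W} {G : OrientedGraph V}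
    {f : W → V} (hinj : Function.Injective f) (hf : ∀ i j, G.Adj (f i) (f j) ↔ H.Adj i j) :
    InducesCopy H G (Set.range f) :=
  ⟨RelIso.symm ⟨Equiv.ofInjective f hinj, by
    intro a b
    exact hf a b⟩⟩

/-- Each copy has 24 orderings of its vertices. Distinct pairs (copy, ordering) give distinct
tuples, and `copiesAt` equals 1 on each. -/
theorem numCopies_le {V : Type*} [Fintype V] (G : OrientedGraph V) :
    24 * (numCopies transitiveMinusArc G : ℝ) ≤
      (28 + 6 * √3) / 169 * (Fintype.card V : ℝ) ^ 4 := by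
  classical
  refine le_trans ?_ (FlagCertificate.sum_copiesAt_le G.sign_antisymm)
  let C := {S : Finset V |
    S.card = Fintype.card (Fin 4) ∧ InducesCopy transitiveMinusArc G (S : Set V)}
  have hC : ∀ S : C, ∃ f : Fin 4 → V, Function.Injective f ∧ Set.range f = (S.1 : Set V) ∧
      ∀ i j, G.Adj (f i) (f j) ↔ transitiveMinusArc.Adj i j := fun S => S.2.2.exists_range_eq
  choose f hinj hrange hadj using hC
  let g : C × Equiv.Perm (Fin 4) → (Fin 4 → V) := fun p => f p.1 ∘ p.2
  have hg : Function.Injective g := by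
    rintro ⟨S, σ⟩ ⟨T, τ⟩ h
    have hST : S = T := by
      have h1 := congrArg Set.range h
      simp only [g, EquivLike.range_comp, hrange] at h1
      exact Subtype.ext (Finset.coe_injective h1)
    subst hST
    have : σ = τ := Equiv.ext fun i => hinj S (congrFun h i)
    rw [this]
  have hone : ∀ p, FlagCertificate.copiesAt G.sign (g p 0) (g p 1) (g p 2) (g p 3) = 1 := by
    rintro ⟨S, σ⟩
    have h := copiesAt_transitiveMinusArc σ
    rw [← sign_comp_of_forall_adj_iff (hadj S)] at h
    exact h
  have hsum : ∑ u : Fin 4 → V, (FlagCertificate.copiesAt G.sign (u 0) (u 1) (u 2) (u 3) : ℝ) =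
      ∑ a, ∑ b, ∑ c, ∑ d, (FlagCertificate.copiesAt G.sign a b c d : ℝ) := by
    simp only [FlagCertificate.sum_fin_succ, Fintype.sum_unique]
    rfl
  have : Fintype C := Fintype.ofFinite C
  rw [← hsum]
  calc 24 * (numCopies transitiveMinusArc G : ℝ)
      = ∑ p : C × Equiv.Perm (Fin 4), (1 : ℝ) := by
        rw [Finset.sum_const, Finset.card_univ, Fintype.card_prod, Fintype.card_perm,
          Fintype.card_fin, numCopies, ← Nat.card_coe_set_eq, Nat.card_eq_fintype_card]
        simp only [nsmul_eq_mul, mul_one, Nat.cast_mul, Nat.factorial]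
        norm_num [C, mul_comm]
    _ = ∑ p, (FlagCertificate.copiesAt G.sign (g p 0) (g p 1) (g p 2) (g p 3) : ℝ) := by
        simp only [hone, Nat.cast_one]
    _ = ∑ u ∈ Finset.univ.map ⟨g, hg⟩,
          (FlagCertificate.copiesAt G.sign (u 0) (u 1) (u 2) (u 3) : ℝ) := by
        rw [Finset.sum_map]; rfl
    _ ≤ _ := Finset.sum_le_sum_of_subset_of_nonneg (Finset.subset_univ _) fun _ _ _ => by positivity

theorem maxCopies_le (n : ℕ) :
    24 * (maxCopies transitiveMinusArc n : ℝ) ≤ (28 + 6 * √3) / 169 * (n : ℝ) ^ 4 := by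
  obtain ⟨G, hG⟩ := (isGreatest_maxCopies transitiveMinusArc n).1
  have h := numCopies_le G
  rw [Fintype.card_fin] at h
  rw [← hG]
  exact h

end OrientedGraph

/-! ### Rotation invariance of the circular graph. -/

/-- Rotation of the circle `[0, 1)` by `-v`. -/
noncomputable def rotate (v x : Set.Ico (0 : ℝ) 1) : Set.Ico (0 : ℝ) 1 :=
  ⟨Int.fract ((x : ℝ) - v), Int.fract_nonneg _, Int.fract_lt_one _⟩

theorem measurable_rotate : Measurable (Function.uncurry rotate) :=
  Measurable.subtype_mk (measurable_fract.comp
    ((measurable_subtype_coe.comp measurable_snd).sub (measurable_subtype_coe.comp measurable_fst)))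

theorem measurePreserving_subtype_val_uniformIco :
    MeasurePreserving Subtype.val uniformIco (volume.restrict (Set.Ico (0 : ℝ) 1)) :=
  ⟨measurable_subtype_coe, map_comap_subtype_coe measurableSet_Ico _⟩

/-- Unit intervals are fundamental domains for the translations by integers, up to the null
difference between `Ico` and `Ioc`. -/
theorem volume_inter_Ico_eq {A : Set ℝ} (hA : MeasurableSet A) (hper : ∀ x, x + 1 ∈ A ↔ x ∈ A)
    (s t : ℝ) : volume (A ∩ Set.Ico s (s + 1)) = volume (A ∩ Set.Ico t (t + 1)) := by
  have h : ∀ r : ℝ, (A ∩ Set.Ico r (r + 1) : Set ℝ) =ᵐ[volume] (A ∩ Set.Ioc r (r + 1) : Set ℝ) :=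
    fun r => (ae_eq_refl A).inter Ico_ae_eq_Ioc
  rw [measure_congr (h s), measure_congr (h t)]
  have hint : ∀ (n : ℤ) (x : ℝ), x + n ∈ A ↔ x ∈ A := by
    intro n x
    induction n with
    | zero => simp
    | succ n ih => rw [← ih, ← hper (x + (n : ℤ))]; push_cast; rw [add_assoc]
    | pred n ih => rw [← ih, ← hper]; push_cast; rw [show x + (-(n : ℝ) - 1) + 1 = x + -n by ring]
  refine (isAddFundamentalDomain_Ioc one_pos s).measure_set_eq
    (isAddFundamentalDomain_Ioc one_pos t) hA fun g => ?_
  obtain ⟨_, n, rfl⟩ := g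
  ext x
  have := hint n x
  simpa [AddSubgroup.vadd_def, add_comm] using this

theorem measurePreserving_rotate (v : Set.Ico (0 : ℝ) 1) :
    MeasurePreserving (rotate v) uniformIco uniformIco := by
  have hm : Measurable (rotate v) := measurable_rotate.comp measurable_prodMk_left
  refine ⟨hm, ?_⟩
  ext s hs
  obtain ⟨S, hS, rfl⟩ := hs
  have hS' : MeasurableSet (Int.fract ⁻¹' S : Set ℝ) := measurable_fract hS
  rw [Measure.map_apply hm (measurable_subtype_coe hS)]
  have h1 : rotate v ⁻¹' (Subtype.val ⁻¹' S) =
      Subtype.val ⁻¹' ((fun x : ℝ => x - v) ⁻¹' (Int.fract ⁻¹' S)) := rfl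
  have h2 : (Subtype.val ⁻¹' S : Set (Set.Ico (0 : ℝ) 1)) =
      Subtype.val ⁻¹' (Int.fract ⁻¹' S : Set ℝ) := by
    ext x
    simp only [Set.mem_preimage, Int.fract_eq_self.mpr x.2]
  have h3 : MeasurableSet ((fun x : ℝ => x - v) ⁻¹' (Int.fract ⁻¹' S)) :=
    (measurable_id.sub_const _) hS'
  rw [h1, h2, measurePreserving_subtype_val_uniformIco.measure_preimage h3.nullMeasurableSet,
    measurePreserving_subtype_val_uniformIco.measure_preimage hS'.nullMeasurableSet,
    Measure.restrict_apply h3, Measure.restrict_apply hS']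
  have h4 : (fun x : ℝ => x - v) ⁻¹' (Int.fract ⁻¹' S) ∩ Set.Ico 0 1 =
      (fun x : ℝ => x - v) ⁻¹' (Int.fract ⁻¹' S ∩ Set.Ico (-v : ℝ) (-v + 1)) := by
    ext x
    simp only [Set.mem_inter_iff, Set.mem_preimage, Set.mem_Ico]
    refine and_congr_right fun _ => ⟨fun h => ⟨by linarith, by linarith⟩,
      fun h => ⟨by linarith, by linarith⟩⟩
  rw [h4, (measurePreserving_sub_right volume (v : ℝ)).measure_preimage
    (hS'.inter measurableSet_Ico).nullMeasurableSet,
    volume_inter_Ico_eq hS' (fun x => by simp) (-v) 0, zero_add]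

/-- In this form adjacency depends only on the difference modulo 1, hence is invariant under
`rotate`. -/
theorem circularGraph_adj_iff {α : ℝ} (hα : α ≤ 1 / 2) (x y : Set.Ico (0 : ℝ) 1) :
    (circularGraph α hα).Adj x y ↔
      0 < Int.fract ((y : ℝ) - x) ∧ Int.fract ((y : ℝ) - x) < α := by
  constructor
  · rintro ⟨hne, a, ⟨ha0, ha⟩, hy⟩
    have h1 : Int.fract ((y : ℝ) - x) = a := by
      rw [← Int.fract_eq_self.mpr (⟨ha0, by linarith⟩ : 0 ≤ a ∧ a < 1), Int.fract_eq_fract]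
      refine ⟨-⌊(x : ℝ) + a⌋, ?_⟩
      have := Int.self_sub_fract ((x : ℝ) + a)
      rw [hy]
      push_cast
      linarith
    rw [h1]
    refine ⟨lt_of_le_of_ne ha0 ?_, ha⟩
    rintro rfl
    refine hne (Subtype.ext ?_)
    rw [hy, add_zero, Int.fract_eq_self.mpr x.2]
  · rintro ⟨h0, h1⟩
    refine ⟨?_, Int.fract ((y : ℝ) - x), ⟨h0.le, h1⟩, ?_⟩
    · rintro rfl
      simp at h0
    · rw [← Int.fract_eq_self.mpr y.2, Int.fract_eq_fract]
      have := Int.self_sub_fract ((y : ℝ) - x)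
      exact ⟨⌊(y : ℝ) - x⌋, by rw [Int.fract_eq_self.mpr y.2]; linarith⟩

theorem fract_rotate_sub (v x y : Set.Ico (0 : ℝ) 1) :
    Int.fract ((rotate v y : ℝ) - rotate v x) = Int.fract ((y : ℝ) - x) := by
  rw [Int.fract_eq_fract]
  refine ⟨⌊(x : ℝ) - v⌋ - ⌊(y : ℝ) - v⌋, ?_⟩
  have h1 := Int.self_sub_fract ((x : ℝ) - v)
  have h2 := Int.self_sub_fract ((y : ℝ) - v)
  simp only [rotate]
  push_cast
  linarith

theorem fract_sub_of_le {a b : ℝ} (ha : 0 ≤ a) (hb : b < 1) (h : a ≤ b) :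
    Int.fract (b - a) = b - a := Int.fract_eq_self.mpr ⟨by linarith, by linarith⟩

theorem fract_sub_of_lt {a b : ℝ} (ha : a < 1) (hb : 0 ≤ b) (h : b < a) :
    Int.fract (b - a) = b - a + 1 := by
  rw [← Int.fract_add_one, Int.fract_eq_self.mpr ⟨by linarith, by linarith⟩]

/-! ### The measure of the labelled copies. -/

/-- The relative positions `a, b, w` of the vertices `x, y, z` with respect to `v` for which
these vertices form a copy in the circular graph. -/
theorem fract_conditions_iff {α : ℝ} (hα : α ≤ 1 / 2) {a b w : ℝ} (ha : a ∈ Set.Ico (0 : ℝ) 1)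
    (hb : b ∈ Set.Ico (0 : ℝ) 1) (hw : w ∈ Set.Ico (0 : ℝ) 1) :
    ((0 < a ∧ a < α) ∧ (0 < b ∧ b < α) ∧
      (0 < Int.fract (b - a) ∧ Int.fract (b - a) < α) ∧
      (0 < Int.fract (w - a) ∧ Int.fract (w - a) < α) ∧
      (0 < Int.fract (w - b) ∧ Int.fract (w - b) < α) ∧
      ¬ (0 < w ∧ w < α) ∧ ¬ (0 < Int.fract (0 - w) ∧ Int.fract (0 - w) < α)) ↔
    (α ≤ w ∧ w ≤ 1 - α) ∧ w - α < a ∧ a < b ∧ b < α := by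
  -- An arc leaving a point p < α cannot wrap past 0: otherwise its length would be at least 1 - p >
  -- 1 - α ≥ α.
  have key : ∀ {p q : ℝ}, p ∈ Set.Ico (0 : ℝ) 1 → q ∈ Set.Ico (0 : ℝ) 1 → p < α →
      0 < Int.fract (q - p) ∧ Int.fract (q - p) < α → p < q ∧ q - p < α := by
    intro p q hp hq hpα h
    rcases le_or_gt p q with hpq | hpq
    · rw [fract_sub_of_le hp.1 hq.2 hpq] at h
      exact ⟨by linarith [h.1], h.2⟩
    · rw [fract_sub_of_lt hp.2 hq.1 hpq] at h
      linarith [h.2, hq.1]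
  constructor
  · rintro ⟨h1, h2, h3, h4, h5, h6, h7⟩
    have k3 := key ha hb h1.2 h3
    have k4 := key ha hw h1.2 h4
    have hw0 : 0 < w := by linarith [h1.1]
    rw [fract_sub_of_lt hw.2 le_rfl hw0] at h7
    refine ⟨⟨?_, ?_⟩, by linarith, k3.1, h2.2⟩
    · by_contra hc
      exact h6 ⟨hw0, not_le.mp hc⟩
    · by_contra hc
      exact h7 ⟨by linarith [hw.2], by linarith [not_le.mp hc]⟩
  · rintro ⟨⟨h1, h2⟩, h3, h4, h5⟩
    rw [fract_sub_of_le ha.1 hb.2 h4.le, fract_sub_of_le ha.1 hw.2 (by linarith),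
      fract_sub_of_le hb.1 hw.2 (by linarith), fract_sub_of_lt hw.2 le_rfl (by linarith)]
    refine ⟨⟨by linarith, by linarith⟩, ⟨by linarith, h5⟩, ⟨by linarith, by linarith⟩,
      ⟨by linarith, by linarith⟩, ⟨by linarith, by linarith⟩, fun h => by linarith [h.2],
      fun h => by linarith [h.2]⟩

instance : IsProbabilityMeasure uniformIco := isProbabilityMeasure_uniformIco

theorem volume_restrict_prod_triangle {l r : ℝ} (hl : 0 ≤ l) (hr : r ≤ 1) (hlr : l ≤ r) :
    ((volume.restrict (Set.Ico (0 : ℝ) 1)).prod (volume.restrict (Set.Ico (0 : ℝ) 1)))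
      {p | l < p.1 ∧ p.1 < p.2 ∧ p.2 < r} = ENNReal.ofReal (1 / 2 * (r - l) ^ 2) := by
  have hm : MeasurableSet {p : ℝ × ℝ | l < p.1 ∧ p.1 < p.2 ∧ p.2 < r} := by measurability
  rw [Measure.prod_apply hm]
  have h1 : ∀ a : ℝ, (volume.restrict (Set.Ico (0 : ℝ) 1))
      (Prod.mk a ⁻¹' {p : ℝ × ℝ | l < p.1 ∧ p.1 < p.2 ∧ p.2 < r}) =
      (Set.Ioc l r).indicator (fun a => ENNReal.ofReal (r - a)) a := by
    intro a
    have h2 : Prod.mk a ⁻¹' {p : ℝ × ℝ | l < p.1 ∧ p.1 < p.2 ∧ p.2 < r} =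
        {b | l < a ∧ a < b ∧ b < r} := rfl
    rw [h2]
    by_cases ha : a ∈ Set.Ioc l r
    · rw [Set.indicator_of_mem ha]
      have h3 : {b | l < a ∧ a < b ∧ b < r} = Set.Ioo a r := by
        ext b
        simp [ha.1]
      rw [h3, Measure.restrict_apply measurableSet_Ioo, Set.inter_eq_self_of_subset_left,
        Real.volume_Ioo]
      exact fun b hb => ⟨by linarith [ha.1, hb.1], by linarith [hb.2]⟩
    · rw [Set.indicator_of_notMem ha]
      have h3 : {b | l < a ∧ a < b ∧ b < r} = ∅ := by
        ext b
        simp only [Set.mem_ofPred_eq, Set.mem_empty_iff_false, iff_false]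
        rintro ⟨k1, k2, k3⟩
        exact ha ⟨k1, by linarith⟩
      rw [h3, measure_empty]
  simp_rw [h1]
  rw [lintegral_indicator measurableSet_Ioc, Measure.restrict_restrict measurableSet_Ioc]
  have h4 : (Set.Ioc l r ∩ Set.Ico 0 1 : Set ℝ) =ᵐ[volume] Set.Ioc l r := by
    have h5 : (Set.Ico (0 : ℝ) 1 : Set ℝ) =ᵐ[volume] Set.Icc 0 1 := Ico_ae_eq_Icc
    refine ((ae_eq_refl _).inter h5).trans (Filter.EventuallyEq.of_eq ?_)
    exact Set.inter_eq_self_of_subset_left fun x hx => ⟨by linarith [hx.1], by linarith [hx.2]⟩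
  rw [Measure.restrict_congr_set h4, ← ofReal_integral_eq_lintegral_ofReal,
    ← intervalIntegral.integral_of_le hlr]
  · congr 1
    rw [intervalIntegral.integral_sub (by simp) (by simp), intervalIntegral.integral_const,
      integral_id, smul_eq_mul]
    ring
  · exact (Continuous.integrableOn_Icc (by fun_prop)).mono_set Set.Ioc_subset_Icc_self
  · filter_upwards [ae_restrict_mem measurableSet_Ioc] with a ha
    simpa using ha.2

/-- The region of relative positions for which the vertices form a copy. -/
def copyRegion (α : ℝ) : Set (Fin 3 → ℝ) :=
  {q | (α ≤ q 2 ∧ q 2 ≤ 1 - α) ∧ q 2 - α < q 0 ∧ q 0 < q 1 ∧ q 1 < α}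

theorem measurableSet_copyRegion (α : ℝ) : MeasurableSet (copyRegion α) := by
  unfold copyRegion
  measurability

/-- Slice by the position w of the sink. The condition 1/3 ≤ α gives w - α ≤ α for w ≤ 1 - α, so
each slice is a genuine, possibly degenerate, triangle. -/
theorem measure_copyRegion {α : ℝ} (h0 : 1 / 3 ≤ α) (h1 : α ≤ 1 / 2) :
    Measure.pi (fun _ : Fin 3 => volume.restrict (Set.Ico (0 : ℝ) 1)) (copyRegion α) =
      ENNReal.ofReal (∫ z in α..(1 - α), 1 / 2 * (α - (z - α)) ^ 2) := by
  let ν := volume.restrict (Set.Ico (0 : ℝ) 1)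
  let D : Set (ℝ × ℝ × ℝ) := {p | (α ≤ p.1 ∧ p.1 ≤ 1 - α) ∧ p.1 - α < p.2.1 ∧
    p.2.1 < p.2.2 ∧ p.2.2 < α}
  have hD : MeasurableSet D := by
    have : Measurable fun p : ℝ × ℝ × ℝ => p.2.1 := measurable_fst.comp measurable_snd
    have : Measurable fun p : ℝ × ℝ × ℝ => p.2.2 := measurable_snd.comp measurable_snd
    simp only [D]
    measurability
  have e1 := measurePreserving_piFinSuccAbove (fun _ : Fin 3 => ν) 2
  have e2 := (MeasurePreserving.id ν).prod (measurePreserving_piFinTwo fun _ : Fin 2 => ν)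
  have e3 := (e2.comp e1).measure_preimage hD.nullMeasurableSet
  have hpre : (Prod.map id (MeasurableEquiv.piFinTwo fun _ => ℝ) ∘
      MeasurableEquiv.piFinSuccAbove (fun _ => ℝ) 2) ⁻¹' D = copyRegion α := rfl
  rw [hpre] at e3
  rw [e3, Measure.prod_apply hD]
  have h2 : ∀ w : ℝ, (ν.prod ν) (Prod.mk w ⁻¹' D) =
      (Set.Icc α (1 - α)).indicator (fun w => ENNReal.ofReal (1 / 2 * (α - (w - α)) ^ 2)) w := by
    intro w
    by_cases hw : w ∈ Set.Icc α (1 - α)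
    · rw [Set.indicator_of_mem hw, ← volume_restrict_prod_triangle (by linarith [hw.1])
        (by linarith) (by linarith [hw.2])]
      congr 1
      ext p
      simp [D, hw.1, hw.2]
    · rw [Set.indicator_of_notMem hw]
      have : Prod.mk w ⁻¹' D = ∅ := by
        ext p
        simp only [D, Set.mem_preimage, Set.mem_ofPred_eq, Set.mem_empty_iff_false, iff_false]
        exact fun h => hw h.1
      rw [this, measure_empty]
  have hsub : Set.Icc α (1 - α) ⊆ Set.Ico (0 : ℝ) 1 :=
    fun w hw => ⟨by linarith [hw.1], by linarith [hw.2]⟩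
  simp_rw [h2]
  rw [lintegral_indicator measurableSet_Icc, Measure.restrict_restrict measurableSet_Icc,
    Set.inter_eq_self_of_subset_left hsub,
    ← ofReal_integral_eq_lintegral_ofReal, integral_Icc_eq_integral_Ioc,
    ← intervalIntegral.integral_of_le (by linarith)]
  · exact Continuous.integrableOn_Icc (by fun_prop)
  · exact Filter.Eventually.of_forall fun w => by positivity

namespace OrientedGraph

/-- The tuples whose entries form, in this order, a copy of `H`. -/
def labelledCopies {V W : Type*} (H : OrientedGraph W) (G : OrientedGraph V) : Set (W → V) :=
  {p | ∀ i j, G.Adj (p i) (p j) ↔ H.Adj i j}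

theorem measure_labelledCopies {α : ℝ} (h0 : 1 / 3 ≤ α) (h1 : α ≤ 1 / 2) :
    MeasurableSet (labelledCopies transitiveMinusArc (circularGraph α h1)) ∧
    Measure.pi (fun _ : Fin 4 => uniformIco)
      (labelledCopies transitiveMinusArc (circularGraph α h1)) =
      ENNReal.ofReal (∫ z in α..(1 - α), 1 / 2 * (α - (z - α)) ^ 2) := by
  let Q := Set.Ico (0 : ℝ) 1
  have e1 := measurePreserving_piFinSuccAbove (fun _ : Fin 4 => uniformIco) 0
  have hrot : Measurable
      (Function.uncurry fun (v : Q) (q : Fin 3 → Q) => fun i => rotate v (q i)) :=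
    measurable_pi_lambda _ fun i => measurable_rotate.comp
      (measurable_fst.prodMk ((measurable_pi_apply i).comp measurable_snd))
  have e2 : MeasurePreserving (fun p : Q × (Fin 3 → Q) => (p.1, fun i => rotate p.1 (p.2 i)))
      (uniformIco.prod (Measure.pi fun _ : Fin 3 => uniformIco))
      (uniformIco.prod (Measure.pi fun _ : Fin 3 => uniformIco)) :=
    -- The rotation depends on the first point, but for each fixed first point it preserves the
    -- measure on the other three.
    (MeasurePreserving.id uniformIco).skew_product hrot (Filter.Eventually.of_forall fun v =>
      (measurePreserving_pi _ _ fun _ => measurePreserving_rotate v).map_eq)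
  have e3 : MeasurePreserving (Prod.snd : Q × (Fin 3 → Q) → (Fin 3 → Q))
      (uniformIco.prod (Measure.pi fun _ : Fin 3 => uniformIco))
      (Measure.pi fun _ : Fin 3 => uniformIco) := measurePreserving_snd
  have e4 : MeasurePreserving (fun (q : Fin 3 → Q) i => (q i : ℝ))
      (Measure.pi fun _ : Fin 3 => uniformIco)
      (Measure.pi fun _ : Fin 3 => volume.restrict (Set.Ico (0 : ℝ) 1)) :=
    measurePreserving_pi _ _ fun _ => measurePreserving_subtype_val_uniformIco
  -- Split off the source, rotate it to 0, forget it, and regard the other three points as reals.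
  have e := e4.comp (e3.comp (e2.comp e1))
  have hset : labelledCopies transitiveMinusArc (circularGraph α h1) =
      (fun p : Fin 4 → Q => fun i : Fin 3 => (rotate (p 0) (p i.succ) : ℝ)) ⁻¹' copyRegion α := by
    ext p
    have hkey := fract_conditions_iff h1 (rotate (p 0) (p 1)).2 (rotate (p 0) (p 2)).2
      (rotate (p 0) (p 3)).2
    have hz : (rotate (p 0) (p 0) : ℝ) = 0 := by simp [rotate]
    have h0w : Int.fract (0 - (rotate (p 0) (p 3) : ℝ)) = Int.fract ((p 0 : ℝ) - p 3) := by
      rw [← fract_rotate_sub (p 0), hz]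
    rw [h0w, fract_rotate_sub, fract_rotate_sub, fract_rotate_sub] at hkey
    rw [Set.mem_preimage]
    refine Iff.trans ?_ hkey
    have hv : ∀ x, (rotate (p 0) x : ℝ) = Int.fract ((x : ℝ) - p 0) := fun _ => rfl
    simp only [hv, ← circularGraph_adj_iff h1]
    have hA := (circularGraph α h1).asymm
    constructor
    · intro h
      have h : ∀ i j, _ := h
      refine ⟨?_, ?_, ?_, ?_, ?_, ?_, ?_⟩ <;> rw [h] <;> unfold transitiveMinusArc <;> decide
    · rintro ⟨a1, a2, a3, a4, a5, a6, a7⟩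
      have hI : ∀ x, ¬ (circularGraph α h1).Adj x x := fun x hx => hA x x hx hx
      intro i j
      fin_cases i <;> fin_cases j <;>
        simp [transitiveMinusArc, a1, a2, a3, a4, a5, a6, a7, hI, hA _ _ a1, hA _ _ a2, hA _ _ a3,
          hA _ _ a4, hA _ _ a5]
  have hmeas := measurableSet_copyRegion α
  rw [hset, ← measure_copyRegion h0 h1]
  exact ⟨e.measurable hmeas, e.measure_preimage hmeas.nullMeasurableSet⟩

end OrientedGraph

/-! ### From labelled to unlabelled density. -/

/-- Any selection of distinct coordinates of an i.i.d. family is again i.i.d. This serves both for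
permuting the four points and for choosing a subset of the sample. -/
theorem measurePreserving_pi_comp {ι κ V : Type*} [Fintype ι] [Fintype κ] [MeasurableSpace V]
    (μ : Measure V) [IsProbabilityMeasure μ] {e : ι → κ} (he : Function.Injective e) :
    MeasurePreserving (fun (p : κ → V) i => p (e i)) (Measure.pi fun _ => μ)
      (Measure.pi fun _ => μ) := by
  classical
  have hm : Measurable fun (p : κ → V) i => p (e i) :=
    measurable_pi_lambda _ fun i => measurable_pi_apply (e i)
  refine ⟨hm, (Measure.pi_eq fun s hs => ?_).symm⟩
  have hpre : (fun (p : κ → V) i => p (e i)) ⁻¹' Set.univ.pi s =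
      Set.univ.pi (Function.extend e s fun _ => Set.univ) := by
    ext p
    simp only [Set.mem_preimage, Set.mem_univ_pi]
    refine ⟨fun h j => ?_, fun h i => ?_⟩
    · by_cases hj : ∃ i, e i = j
      · obtain ⟨i, rfl⟩ := hj
        rw [he.extend_apply]
        exact h i
      · rw [Function.extend_apply' _ _ _ hj]
        trivial
    · have := h (e i)
      rwa [he.extend_apply] at this
  rw [Measure.map_apply hm (.univ_pi hs), hpre, Measure.pi_pi]
  refine (Fintype.prod_of_injective e he _ _ (fun j hj => ?_) fun i => ?_).symm
  · rw [Function.extend_apply' _ _ _ hj, measure_univ]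
  · rw [he.extend_apply]

namespace OrientedGraph

theorem exists_perm_of_range_eq {V W : Type*} [Finite W] {f p : W → V}
    (hf : Function.Injective f) (h : Set.range f = Set.range p) :
    ∃ σ : Equiv.Perm W, ∀ i, p (σ i) = f i := by
  have hmem : ∀ i, ∃ j, p j = f i := fun i => by
    rw [← Set.mem_range, ← h]
    exact Set.mem_range_self i
  choose σ hσ using hmem
  have hinj : Function.Injective σ := fun i j hij => hf (by rw [← hσ, ← hσ, hij])
  exact ⟨Equiv.ofBijective σ (Finite.injective_iff_bijective.mp hinj), hσ⟩

/-- The four vertices of H have pairwise distinct out-neighbourhoods. -/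
theorem injective_of_mem_labelledCopies {V : Type*} {G : OrientedGraph V} {p : Fin 4 → V}
    (h : p ∈ labelledCopies transitiveMinusArc G) : Function.Injective p := by
  intro i j hij
  have h1 : ∀ k, transitiveMinusArc.Adj i k ↔ transitiveMinusArc.Adj j k := fun k => by
    rw [← h i k, ← h j k, hij]
  clear hij h
  unfold transitiveMinusArc at h1
  revert i j
  decide

theorem setOf_inducesCopy_eq_iUnion {V : Type*} (G : OrientedGraph V) :
    {p : Fin 4 → V | InducesCopy transitiveMinusArc G (Set.range p)} =
      ⋃ σ : Equiv.Perm (Fin 4),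
        (fun (p : Fin 4 → V) i => p (σ i)) ⁻¹' labelledCopies transitiveMinusArc G := by
  ext p
  rw [Set.mem_iUnion]
  constructor
  · rintro h
    obtain ⟨f, hf, hr, hadj⟩ := InducesCopy.exists_range_eq h
    obtain ⟨σ, hσ⟩ := exists_perm_of_range_eq hf hr
    refine ⟨σ, fun i j => ?_⟩
    simp only [hσ]
    exact hadj i j
  · rintro ⟨σ, hσ⟩
    have := inducesCopy_range (injective_of_mem_labelledCopies hσ) hσ
    rwa [show (fun (p : Fin 4 → V) i => p (σ i)) p = p ∘ σ from rfl, EquivLike.range_comp] at this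

theorem perm_eq_one_of_adj_iff : ∀ ρ : Equiv.Perm (Fin 4),
    (∀ i j, transitiveMinusArc.Adj (ρ i) (ρ j) ↔ transitiveMinusArc.Adj i j) → ρ = 1 := by
  unfold transitiveMinusArc
  decide +kernel

/-- Two labellings of the same points would differ by an automorphism of H, and H has only the
identity. -/
theorem pairwise_disjoint_labelledCopies {V : Type*} (G : OrientedGraph V) :
    Pairwise (Function.onFun Disjoint fun σ : Equiv.Perm (Fin 4) =>
      (fun (p : Fin 4 → V) i => p (σ i)) ⁻¹' labelledCopies transitiveMinusArc G) := by
  intro σ τ hne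
  rw [Function.onFun, Set.disjoint_left]
  intro p hσ hτ
  have h : σ⁻¹ * τ = 1 := perm_eq_one_of_adj_iff _ fun i j => by
    rw [← hσ, ← hτ i j]
    simp
  exact hne (inv_mul_eq_one.mp h)

theorem measurableSet_inducesCopy {V : Type*} [MeasurableSpace V] {G : OrientedGraph V}
    (hG : MeasurableSet (labelledCopies transitiveMinusArc G)) :
    MeasurableSet {p : Fin 4 → V | InducesCopy transitiveMinusArc G (Set.range p)} := by
  rw [setOf_inducesCopy_eq_iUnion]
  exact .iUnion fun σ => measurable_pi_lambda _ (fun i => measurable_pi_apply (σ i)) hG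

theorem density_transitiveMinusArc {V : Type*} [MeasurableSpace V] {G : OrientedGraph V}
    (μ : Measure V) [IsProbabilityMeasure μ]
    (hG : MeasurableSet (labelledCopies transitiveMinusArc G)) :
    density transitiveMinusArc G μ = (Nat.factorial 4 : ℝ) *
      (Measure.pi fun _ => μ).real (labelledCopies transitiveMinusArc G) := by
  rw [density, Measure.real, setOf_inducesCopy_eq_iUnion, measure_iUnion
    (pairwise_disjoint_labelledCopies G)
    fun σ => measurable_pi_lambda _ (fun i => measurable_pi_apply (σ i)) hG]
  simp_rw [(measurePreserving_pi_comp μ (Equiv.injective _)).measure_preimage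
    hG.nullMeasurableSet]
  rw [tsum_fintype, Finset.sum_const, Finset.card_univ, Fintype.card_perm, Fintype.card_fin,
    nsmul_eq_mul, ENNReal.toReal_mul, ENNReal.toReal_natCast, Measure.real]

/-! ### The lower bound by random sampling. -/

/-- The graph that the vertices `p i` of `G` induce on the indices `i`. -/
def comap {V W : Type*} (G : OrientedGraph V) (p : W → V) : OrientedGraph W where
  Adj i j := G.Adj (p i) (p j)
  asymm i j := G.asymm (p i) (p j)

theorem InducesCopy.comap {U V W : Type*} [Finite W] {H : OrientedGraph W} {G : OrientedGraph V}
    {p : U → V} {e : W → U} (he : Function.Injective e)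
    (h : InducesCopy H G (Set.range fun i => p (e i))) :
    InducesCopy H (G.comap p) (Set.range e) := by
  obtain ⟨f, hf, hr, hadj⟩ := h.exists_range_eq
  obtain ⟨σ, hσ⟩ := exists_perm_of_range_eq hf hr
  rw [← EquivLike.range_comp e σ]
  refine inducesCopy_range (he.comp σ.injective) fun i j => ?_
  rw [← hadj i j, ← hσ i, ← hσ j]
  rfl

/-- First-moment argument: each k-subset of the n sampled indices induces a copy with probability
equal to the density. Coinciding sample points do no harm, since `comap` is still an oriented graph
on n vertices. -/
theorem choose_mul_density_le_maxCopies {V W : Type*} [Fintype W] [MeasurableSpace V]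
    {H : OrientedGraph W} {G : OrientedGraph V} (μ : Measure V) [IsProbabilityMeasure μ]
    (hA : MeasurableSet {p : W → V | InducesCopy H G (Set.range p)}) (n : ℕ) :
    (n.choose (Fintype.card W) : ℝ) * density H G μ ≤ maxCopies H n := by
  classical
  let T := (Finset.univ : Finset (Fin n)).powersetCard (Fintype.card W)
  have hT : ∀ S : T, ∃ e : W → Fin n, Function.Injective e ∧ Set.range e = (S.1 : Set (Fin n)) := by
    intro S
    have hc : Fintype.card W = Fintype.card S.1 := by
      rw [Fintype.card_coe, (Finset.mem_powersetCard.mp S.2).2]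
    refine ⟨fun i => (Fintype.equivOfCardEq hc i : Fin n),
      Subtype.val_injective.comp (Equiv.injective _), ?_⟩
    change Set.range (Subtype.val ∘ Fintype.equivOfCardEq hc) = _
    rw [EquivLike.range_comp, Subtype.range_coe]
  choose e he hr using hT
  let A := {p : W → V | InducesCopy H G (Set.range p)}
  let E : T → Set (Fin n → V) := fun S => (fun p i => p (e S i)) ⁻¹' A
  have hmp := fun S => measurePreserving_pi_comp μ (he S)
  have hE : ∀ S, MeasurableSet (E S) := fun S => (hmp S).measurable hA
  let ν : Measure (Fin n → V) := Measure.pi fun _ => μ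
  have hint : ∀ S ∈ (Finset.univ : Finset T),
      Integrable ((E S).indicator (1 : (Fin n → V) → ℝ)) ν := fun S _ =>
    (integrable_const (1 : ℝ)).indicator (hE S)
  -- Some sample has at least the mean number of copies.
  obtain ⟨p, hp⟩ := exists_integral_le (integrable_finsetSum _ hint)
  have hsum : ∫ p, ∑ S, (E S).indicator (1 : (Fin n → V) → ℝ) p ∂ν =
      (n.choose (Fintype.card W) : ℝ) * density H G μ := by
    rw [integral_finsetSum _ hint]
    have h1 : ∀ S, ∫ p, (E S).indicator (1 : (Fin n → V) → ℝ) p ∂ν = density H G μ := by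
      intro S
      rw [integral_indicator_one (hE S), Measure.real,
        (hmp S).measure_preimage hA.nullMeasurableSet]
      rfl
    simp only [h1, Finset.sum_const, Finset.card_univ, Fintype.card_coe, T,
      Finset.card_powersetCard, Fintype.card_fin, nsmul_eq_mul]
  rw [hsum] at hp
  refine hp.trans ?_
  have hmax : numCopies H (G.comap p) ≤ maxCopies H n :=
    (isGreatest_maxCopies H n).2 ⟨G.comap p, rfl⟩
  refine le_trans ?_ (Nat.cast_le.mpr hmax)
  have hcard : ∑ S, (E S).indicator (1 : (Fin n → V) → ℝ) p =
      ((Finset.univ.filter fun S => p ∈ E S).map (Function.Embedding.subtype _)).card := by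
    rw [Finset.card_map, Finset.card_filter, Nat.cast_sum]
    refine Finset.sum_congr rfl fun S _ => ?_
    simp [Set.indicator_apply]
  rw [hcard, numCopies, ← Set.ncard_coe_finset]
  refine Nat.cast_le.mpr (Set.ncard_le_ncard ?_ (Set.toFinite _))
  intro S hS
  simp only [Finset.coe_map, Set.mem_image, Finset.mem_coe, Finset.mem_filter, Finset.mem_univ,
    true_and] at hS
  obtain ⟨S, hSE, rfl⟩ := hS
  refine ⟨(Finset.mem_powersetCard.mp S.2).2, ?_⟩
  have h := InducesCopy.comap (he S) hSE
  rw [hr] at h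
  exact h

end OrientedGraph

/-! ### The value of the density and the limit. -/

theorem integral_circularParam :
    (Nat.factorial 4 : ℝ) *
        (∫ z in circularParam..(1 - circularParam),
          (1 / 2) * (circularParam - (z - circularParam)) ^ 2) =
      (28 + 6 * √3) / 169 := by
  -- This antiderivative gives the density 4(α³ - (3α - 1)³). Its derivative in α vanishes when α =
  -- √3(3α - 1), that is at α = (9 + √3)/26, its maximum on [1/3, 1/2].
  have h : ∀ z ∈ Set.uIcc circularParam (1 - circularParam),
      HasDerivAt (fun z => -(1 / 6) * (2 * circularParam - z) ^ 3)
        ((1 / 2) * (circularParam - (z - circularParam)) ^ 2) z := by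
    intro z _
    refine ((((hasDerivAt_id z).const_sub (2 * circularParam)).pow 3).const_mul
      (-(1 / 6))).congr_deriv ?_
    simp
    ring
  rw [intervalIntegral.integral_eq_sub_of_hasDerivAt h
    (Continuous.intervalIntegrable (by fun_prop) _ _)]
  have h3 : √3 ^ 3 = 3 * √3 := by rw [pow_succ, Real.sq_sqrt (by norm_num)]
  unfold circularParam
  norm_num [Nat.factorial]
  ring_nf
  rw [h3]
  ring

namespace OrientedGraph

theorem tendsto_pow_div_choose (k : ℕ) :
    Tendsto (fun n : ℕ => (n : ℝ) ^ k / (k.factorial * n.choose k : ℝ)) atTop (𝓝 1) := by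
  have hpos : ∀ᶠ n : ℕ in atTop, (n.choose k : ℝ) ≠ 0 := by
    filter_upwards [eventually_ge_atTop k] with n hn
    exact_mod_cast (Nat.choose_pos hn).ne'
  refine ((Asymptotics.isEquivalent_iff_tendsto_one hpos).mp
    (isEquivalent_choose k).symm).congr fun n => ?_
  rw [Pi.div_apply, div_div]

/-- Squeeze: the lower bound is exact for every n, and the upper one is c times a ratio tending to
1. -/
theorem hasInducibility_of_le {W : Type*} [Fintype W] {H : OrientedGraph W} {c : ℝ}
    (hl : ∀ n : ℕ, (n.choose (Fintype.card W) : ℝ) * c ≤ maxCopies H n)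
    (hu : ∀ n : ℕ, ((Fintype.card W).factorial : ℝ) * maxCopies H n ≤ c * n ^ (Fintype.card W)) :
    HasInducibility H c := by
  have h := (tendsto_pow_div_choose (Fintype.card W)).const_mul c
  rw [mul_one] at h
  refine tendsto_of_tendsto_of_tendsto_of_le_of_le' tendsto_const_nhds h ?_ ?_ <;>
    filter_upwards [eventually_ge_atTop (Fintype.card W)] with n hn
  · rw [le_div_iff₀ (Nat.cast_pos.mpr (Nat.choose_pos hn)), mul_comm]
    exact hl n
  · have h1 : (0 : ℝ) < n.choose (Fintype.card W) := Nat.cast_pos.mpr (Nat.choose_pos hn)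
    have h2 : (0 : ℝ) < (Fintype.card W).factorial := Nat.cast_pos.mpr (Nat.factorial_pos _)
    rw [← mul_div_assoc, div_le_div_iff₀ h1 (mul_pos h2 h1)]
    nlinarith [mul_le_mul_of_nonneg_right (hu n) h1.le]

end OrientedGraph

theorem density_circularGraph {α : ℝ} (h0 : 1 / 3 ≤ α) (h1 : α ≤ 1 / 2) :
    OrientedGraph.density transitiveMinusArc (circularGraph α h1) uniformIco =
      (Nat.factorial 4 : ℝ) * (∫ z in α..(1 - α), (1 / 2) * (α - (z - α)) ^ 2) := by
  have h := OrientedGraph.measure_labelledCopies h0 h1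
  rw [OrientedGraph.density_transitiveMinusArc _ h.1, Measure.real, h.2, ENNReal.toReal_ofReal]
  exact intervalIntegral.integral_nonneg (by linarith) fun z _ => by positivity

theorem mainTheorem7 :
    OrientedGraph.HasInducibility transitiveMinusArc ((28 + 6 * √3) / 169) ∧
    OrientedGraph.density transitiveMinusArc
        (circularGraph circularParam circularParam_le_half) uniformIco =
      (Nat.factorial 4 : ℝ) *
        (∫ z in circularParam..(1 - circularParam),
          (1 / 2) * (circularParam - (z - circularParam)) ^ 2) ∧
    (Nat.factorial 4 : ℝ) *
        (∫ z in circularParam..(1 - circularParam),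
          (1 / 2) * (circularParam - (z - circularParam)) ^ 2) =
      (28 + 6 * √3) / 169 := by
  have h0 : 1 / 3 ≤ circularParam := by
    have : (1 : ℝ) ≤ √3 := Real.one_le_sqrt.mpr (by norm_num)
    unfold circularParam
    linarith
  have hd := density_circularGraph h0 circularParam_le_half
  refine ⟨OrientedGraph.hasInducibility_of_le (fun n => ?_) fun n => ?_, hd,
    integral_circularParam⟩
  · rw [← integral_circularParam, ← hd]
    exact OrientedGraph.choose_mul_density_le_maxCopies uniformIco
      (OrientedGraph.measurableSet_inducesCopy
        (OrientedGraph.measure_labelledCopies h0 circularParam_le_half).1) n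
  · simpa [Nat.factorial] using OrientedGraph.maxCopies_le n
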